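/- Let $X$ be a non-degenerate real random variable (that is, $X$ is not almost surely constant) with characteristic function $f(t)=\mathbb{E}\,e^{itX}$, and suppose that $f$ is analytic in a disk $|t|<r$, $r>0$. Let $g=\log f$ be the continuous branch with $g(0)=0$, and let $\varkappa_k$ be the cumulants of $X$, defined by $g(t)=\sum_{k\ge 0} i^k\varkappa_k t^k/k!$ near $t=0$. Suppose that the set $\{\varkappa_k/k! : k=0,1,2,\dots\}$ is finite. Then $f$ has no zeros on the real line, and, on the whole real line and in a complex neighbourhood of $0$ (where $g$ is the sum of the above power series), one of the following holds: 1. $g(t)=-\sigma^2t^2+iat$ with some real $\sigma\ge 0$ and $a\in\mathbb{R}$; 2. $g(t)=\dfrac{P(t)}{1+it}$ or $g(t)=\dfrac{P(t)}{1-it}$, where $P$ is a polynomial with complex coefficients that does not vanish at the zero of the denominator (that is, $P(i)\ne 0$, respectively $P(-i)\neq 0$); 3. $g(t)=\dfrac{P(t)}{1+t^2}$, where $P$ is a polynomial with complex coefficients and $P(i)\ne 0$, $P(-i)\neq 0$. -/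

import Mathlib

open MeasureTheory ProbabilityTheory Complex Filter Topology

noncomputable section

/-- The characteristic function `t ↦ ∫ exp (i t x) dμ` of the distribution `μ` is analytic in the
disk `|t| < r`: on the real points of this disk it agrees with a function that is analytic there. -/
def CharFunAnalyticInDisk (μ : Measure ℝ) (r : ℝ) : Prop :=
  ∃ F : ℂ → ℂ, AnalyticOnNhd ℂ F (Metric.ball 0 r) ∧
    ∀ t : ℝ, |t| < r → F (t : ℂ) = charFun μ t

/-- The `k`-th cumulant of `μ`, defined by `log f (t) = ∑ i ^ k * ϰ_k * t ^ k / k!`, that is,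
`i ^ k * ϰ_k` is the `k`-th derivative of `log f` at `0`. As `f 0 = 1`, the principal branch
is the right one near `0`. -/
def charCumulant (μ : Measure ℝ) (k : ℕ) : ℂ :=
  (I ^ k)⁻¹ * iteratedDeriv k (fun t : ℝ => Complex.log (charFun μ t)) 0

/-- The set of values of `ϰ_k / k!`, `k = 0, 1, 2, …`. -/
def cumulantRatios (μ : Measure ℝ) : Set ℂ :=
  Set.range fun k : ℕ => charCumulant μ k / (k.factorial : ℂ)

/-- `g` is the logarithm of the characteristic function of `μ`: on the real line it is the
continuous logarithm that vanishes at `0`, and near `0` in the complex plane it is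
the sum of the power series `∑ i ^ k * ϰ_k * z ^ k / k!`. -/
structure IsLogCharFun (μ : Measure ℝ) (g : ℂ → ℂ) : Prop where
  map_zero : g 0 = 0
  continuous_real : Continuous fun t : ℝ => g (t : ℂ)
  exp_eq : ∀ t : ℝ, Complex.exp (g (t : ℂ)) = charFun μ t
  hasSum : ∀ᶠ z : ℂ in 𝓝 0,
    HasSum (fun k : ℕ => I ^ k * charCumulant μ k * z ^ k / (k.factorial : ℂ)) (g z)

end

/-! Put `c k = ϰ_k / k!` and `h z = ∑ c k * z ^ k`, so that `f t = exp (h (i t))` for `t` near `0`.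
Finitely many coefficient values are bounded, hence `h` is analytic in the unit disk. Positivity of
the even moments turns this into finiteness of all exponential moments of order less than `1`, so
the moment generating function `M` is analytic in the strip `|re z| < 1` and equals `exp h` in the
disk.

The strip contains the unit circle except `±1`. Since `M` has isolated zeros, `h = log M` continues
across some point of the circle, and Szegő's theorem (`exists_eventually_periodic_coeff`) makes the
coefficients eventually periodic: `h = Q / (1 - z ^ P)`. At a root of unity other than `±1`, a pole
of `h` would give `M' / M = h'` a double pole, while the logarithmic derivative of an analytic `M ≢
0` has at most simple poles. Hence `h = R / (1 - z ^ 2)` (`exists_rational_log`), and `M` has no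
zeros on the imaginary axis.

Whether `R` vanishes at `1` and at `-1` separates the cases. If it vanishes at both, `h` is a
polynomial, and the ridge inequality `|M z| ≤ M (re z)` forces a real quadratic, as in
Marcinkiewicz's theorem. -/

/-! ### Derivatives along the real line and second differences. -/

lemma AnalyticAt.iteratedDeriv_analyticAt {G : ℂ → ℂ} {z : ℂ} (h : AnalyticAt ℂ G z) (n : ℕ) :
    AnalyticAt ℂ (iteratedDeriv n G) z := by
  rw [iteratedDeriv_eq_iterate]
  exact h.iterated_deriv n

/-- The iterated derivatives of the restriction of an analytic function to the real line are the
restrictions of its complex iterated derivatives. -/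
lemma iteratedDeriv_comp_ofReal {G : ℂ → ℂ} (n : ℕ) {s : ℝ} (h : AnalyticAt ℂ G s) :
    iteratedDeriv n (fun t : ℝ => G t) s = iteratedDeriv n G s := by
  induction n generalizing s with
  | zero => simp
  | succ n ih =>
    have hev : ∀ᶠ t : ℝ in 𝓝 s, AnalyticAt ℂ G t :=
      (Complex.continuous_ofReal.tendsto s).eventually h.eventually_analyticAt
    have heq : iteratedDeriv n (fun t : ℝ => G t) =ᶠ[𝓝 s] fun t : ℝ => iteratedDeriv n G t :=
      hev.mono fun t ht => ih ht
    rw [iteratedDeriv_succ, iteratedDeriv_succ, heq.deriv_eq]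
    exact ((h.iteratedDeriv_analyticAt n).differentiableAt.hasDerivAt.comp_ofReal).deriv

/-- The linear Taylor terms at `t` and `-t` cancel. Applied to even derivatives of the
characteristic function, this controls the next even moment. -/
lemma exists_second_difference_bound {G : ℂ → ℂ} (h : AnalyticAt ℂ G 0) :
    ∃ C : ℝ, ∀ᶠ t : ℝ in 𝓝 0, ‖2 * G 0 - G t - G (-t : ℝ)‖ ≤ C * t ^ 2 := by
  obtain ⟨p, hp⟩ := h
  obtain ⟨C, hC⟩ := (hp.isBigO_sub_partialSum_pow 2).bound
  have hpos : ∀ᶠ t : ℝ in 𝓝 0, ‖G (0 + (t : ℂ)) - p.partialSum 2 t‖ ≤ C * ‖‖(t : ℂ)‖ ^ 2‖ := by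
    have : Tendsto (fun t : ℝ => (t : ℂ)) (𝓝 0) (𝓝 0) :=
      Complex.continuous_ofReal.tendsto' _ _ (by simp)
    exact this.eventually hC
  have hneg : ∀ᶠ t : ℝ in 𝓝 0,
      ‖G (0 + ((-t : ℝ) : ℂ)) - p.partialSum 2 (-t : ℝ)‖ ≤ C * ‖‖((-t : ℝ) : ℂ)‖ ^ 2‖ := by
    have : Tendsto (fun t : ℝ => -t) (𝓝 0) (𝓝 0) := continuous_neg.tendsto' _ _ (by simp)
    exact this.eventually hpos
  have h0 : p 0 (fun _ => 0) = G 0 := hp.coeff_zero _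
  refine ⟨2 * C, ?_⟩
  filter_upwards [hpos, hneg] with t h1 h2
  have hs : ∀ z : ℂ, p.partialSum 2 z = G 0 + z * p.coeff 1 := by
    intro z
    simp only [FormalMultilinearSeries.partialSum, Finset.sum_range_succ, Finset.sum_range_zero,
      zero_add, FormalMultilinearSeries.apply_eq_pow_smul_coeff, pow_zero, pow_one,
      smul_eq_mul, add_left_inj]
    rw [← h0, FormalMultilinearSeries.coeff]
    rw [one_mul]
    exact congrArg _ (Subsingleton.elim _ _)
  rw [hs, zero_add] at h1 h2
  have e : 2 * G 0 - G t - G (-t : ℝ) =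
      -((G t - (G 0 + (t : ℂ) * p.coeff 1)) +
        (G (-t : ℝ) - (G 0 + ((-t : ℝ) : ℂ) * p.coeff 1))) := by
    push_cast; ring
  rw [e, norm_neg]
  refine (norm_add_le _ _).trans ((add_le_add h1 h2).trans (le_of_eq ?_))
  simp
  ring

/-! ### Moments and exponential moments from analyticity of the characteristic function. -/

section Moments

variable {μ : Measure ℝ} [IsProbabilityMeasure μ] {G : ℂ → ℂ}

/-- This is `2 - exp (2iu) - exp (-2iu) = 4 sin² u` with `u = t x`, integrated: up to sign, a second
difference of the derivative of order `2k` is the integral of a nonnegative function. -/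
lemma ofReal_integral_pow_mul_sin_sq {k : ℕ} (hint : MemLp id ((2 * k : ℕ) : ENNReal) μ) (t : ℝ) :
    2 * iteratedDeriv (2 * k) (charFun μ) 0 - iteratedDeriv (2 * k) (charFun μ) (2 * t) -
      iteratedDeriv (2 * k) (charFun μ) (-(2 * t)) =
      I ^ (2 * k) * ((∫ x, x ^ (2 * k) * (4 * Real.sin (t * x) ^ 2) ∂μ : ℝ) : ℂ) := by
  have hi : ∀ s : ℝ, Integrable (fun x : ℝ => (x : ℂ) ^ (2 * k) * exp (s * x * I)) μ := by
    intro s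
    have hn : Integrable (fun x : ℝ => ‖id x‖ ^ (2 * k)) μ := hint.integrable_norm_pow'
    refine hn.mono' (by fun_prop) (ae_of_all _ fun x => ?_)
    have : (s : ℂ) * x * I = ((s * x : ℝ) : ℂ) * I := by push_cast; ring
    rw [norm_mul, this, norm_exp_ofReal_mul_I]
    simp
  rw [iteratedDeriv_charFun hint, iteratedDeriv_charFun hint, iteratedDeriv_charFun hint,
    mul_left_comm, ← mul_sub, ← mul_sub, ← integral_const_mul,
    ← integral_sub ((hi 0).const_mul 2) (hi _),
    ← integral_sub (by exact ((hi 0).const_mul 2).sub (hi _)) (hi _), ← integral_complex_ofReal]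
  congr 1
  refine integral_congr_ae (ae_of_all _ fun x => ?_)
  simp only [ofReal_mul, ofReal_pow, ofReal_sin, ofReal_ofNat,
    ofReal_zero, zero_mul, exp_zero, ofReal_neg, mul_one]
  have e1 : exp (2 * t * x * I) = exp (t * x * I) ^ 2 := by
    rw [← exp_nat_mul]; congr 1; push_cast; ring
  have e2 : exp (-(2 * t) * x * I) = exp (-(t * x) * I) ^ 2 := by
    rw [← exp_nat_mul]; congr 1; push_cast; ring
  have e3 : exp (t * x * I) * exp (-(t * x) * I) = 1 := by
    rw [← exp_add]; simp
  rw [Complex.sin, e1, e2]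
  linear_combination (-2 * (x : ℂ) ^ (2 * k)) * e3 - (x : ℂ) ^ (2 * k) *
    (exp (-(t * x) * I) - exp (t * x * I)) ^ 2 * I_sq

lemma tendsto_sin_mul_div (x : ℝ) :
    Tendsto (fun n : ℕ => Real.sin ((1 / ((n : ℝ) + 1)) * x) / (1 / ((n : ℝ) + 1))) atTop (𝓝 x) := by
  have hd : HasDerivAt (fun t : ℝ => Real.sin (t * x)) x 0 := by
    simpa using ((hasDerivAt_id (0 : ℝ)).mul_const x).sin
  have hs := hd.tendsto_slope_zero
  have hn : Tendsto (fun n : ℕ => 1 / ((n : ℝ) + 1)) atTop (𝓝[≠] 0) :=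
    tendsto_nhdsWithin_iff.2 ⟨tendsto_one_div_add_atTop_nhds_zero_nat,
      Eventually.of_forall fun n => (by positivity : (0 : ℝ) < 1 / ((n : ℝ) + 1)).ne'⟩
  refine (hs.comp hn).congr fun n => ?_
  simp [div_eq_inv_mul]

/-- If the characteristic function agrees near `0` with an analytic function then all moments are
finite. -/
lemma memLp_id_of_charFun_analytic (hG : AnalyticAt ℂ G 0)
    (heq : ∀ᶠ t : ℝ in 𝓝 0, charFun μ t = G t) (n : ℕ) : MemLp id (n : ENNReal) μ := by
  -- Even orders suffice because `n ≤ 2n` and `μ` is finite; the induction raises the order by two.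
  suffices H : ∀ k : ℕ, MemLp id ((2 * k : ℕ) : ENNReal) μ from
    (H n).mono_exponent (by exact_mod_cast (by omega))
  intro k
  induction k with
  | zero => simpa using aestronglyMeasurable_id
  | succ k ih =>
    have hev : ∀ᶠ t : ℝ in 𝓝 0, iteratedDeriv (2 * k) (charFun μ) t = iteratedDeriv (2 * k) G t := by
      have hev' : ∀ᶠ t : ℝ in 𝓝 0, AnalyticAt ℂ G t :=
        (Complex.continuous_ofReal.tendsto' 0 0 (by simp)).eventually hG.eventually_analyticAt
      have heq' : charFun μ =ᶠ[𝓝 0] fun t : ℝ => G t := heq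
      filter_upwards [heq'.eventuallyEq_nhds, hev'] with t h1 h2
      rw [h1.iteratedDeriv_eq, iteratedDeriv_comp_ofReal _ h2]
    obtain ⟨C, hC⟩ := exists_second_difference_bound (hG.iteratedDeriv_analyticAt (2 * k))
    have hev2 : ∀ᶠ t : ℝ in 𝓝 0,
        ∫ x, x ^ (2 * k) * (4 * Real.sin (t * x) ^ 2) ∂μ ≤ C * (2 * t) ^ 2 := by
      have t1 : Tendsto (fun t : ℝ => 2 * t) (𝓝 0) (𝓝 0) :=
        (continuous_const.mul continuous_id).tendsto' _ _ (by simp)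
      have t2 : Tendsto (fun t : ℝ => -(2 * t)) (𝓝 0) (𝓝 0) :=
        (continuous_const.mul continuous_id).neg.tendsto' _ _ (by simp)
      filter_upwards [t1.eventually hev, t2.eventually hev, t1.eventually hC] with t h1 h2 h3
      have key := ofReal_integral_pow_mul_sin_sq ih t
      rw [h1, h2, hev.self_of_nhds, ofReal_zero] at key
      rw [key, norm_mul, norm_pow, norm_I, one_pow, one_mul, norm_real] at h3
      exact (le_abs_self _).trans h3
    have hn : Tendsto (fun n : ℕ => 1 / ((n : ℝ) + 1)) atTop (𝓝 0) :=
      tendsto_one_div_add_atTop_nhds_zero_nat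
    have hpow : Integrable (fun x : ℝ => x ^ (2 * k)) μ := by
      have : Integrable (fun x : ℝ => ‖id x‖ ^ (2 * k)) μ := ih.integrable_norm_pow'
      simpa [pow_mul] using this
    have hint : Integrable (fun x : ℝ => x ^ (2 * k) * (4 * x ^ 2)) μ := by
      -- Fatou's lemma with `sin (s x) / s → x`. The integrals stay below `C * (2 s) ^ 2 / s ^ 2 = 4
      -- C`.
      refine integrable_of_tendsto (G := fun n x => x ^ (2 * k) *
        (4 * (Real.sin ((1 / ((n : ℝ) + 1)) * x) / (1 / ((n : ℝ) + 1))) ^ 2))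
        (ae_of_all _ fun x => (((tendsto_sin_mul_div x).pow 2).const_mul 4).const_mul _)
        (fun n => by fun_prop) ?_
      refine ne_top_of_le_ne_top (b := ENNReal.ofReal (C * 4)) ENNReal.ofReal_ne_top ?_
      refine liminf_le_of_frequently_le' (Eventually.frequently ?_)
      filter_upwards [hn.eventually hev2] with n h
      have hs : (0 : ℝ) < 1 / ((n : ℝ) + 1) := by positivity
      generalize 1 / ((n : ℝ) + 1) = s at h hs
      have e : (fun x : ℝ => x ^ (2 * k) * (4 * (Real.sin (s * x) / s) ^ 2)) =
          fun x => (s ^ 2)⁻¹ * (x ^ (2 * k) * (4 * Real.sin (s * x) ^ 2)) := by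
        ext x; field_simp
      have hi : Integrable (fun x : ℝ => x ^ (2 * k) * (4 * (Real.sin (s * x) / s) ^ 2)) μ := by
        rw [e]
        refine Integrable.const_mul ?_ _
        refine (hpow.mul_const 4).mono (by fun_prop) (ae_of_all _ fun x => ?_)
        rw [norm_mul, norm_mul _ (4 : ℝ)]
        refine mul_le_mul_of_nonneg_left ?_ (norm_nonneg _)
        rw [norm_mul, norm_pow, Real.norm_eq_abs (Real.sin _), sq_abs]
        nlinarith [Real.sin_sq_le_one (s * x), norm_nonneg (4 : ℝ)]
      have hnn : ∀ x : ℝ, 0 ≤ x ^ (2 * k) * (4 * (Real.sin (s * x) / s) ^ 2) := fun x => by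
        rw [pow_mul]; positivity
      have e2 : ∫⁻ x, ‖x ^ (2 * k) * (4 * (Real.sin (s * x) / s) ^ 2)‖ₑ ∂μ =
          ENNReal.ofReal (∫ x, x ^ (2 * k) * (4 * (Real.sin (s * x) / s) ^ 2) ∂μ) := by
        rw [ofReal_integral_eq_lintegral_ofReal hi (ae_of_all _ hnn)]
        exact lintegral_congr fun x => by rw [Real.enorm_eq_ofReal (hnn x)]
      rw [e2]
      refine ENNReal.ofReal_le_ofReal ?_
      rw [e, integral_const_mul, inv_mul_le_iff₀ (by positivity)]
      linarith
    have hne : ((2 * (k + 1) : ℕ) : ENNReal) ≠ 0 := by simp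
    rw [← integrable_norm_rpow_iff aestronglyMeasurable_id hne (ENNReal.natCast_ne_top _)]
    refine (hint.const_mul 4⁻¹).congr (ae_of_all _ fun x => ?_)
    simp only [ENNReal.toReal_natCast, Real.rpow_natCast, id, Real.norm_eq_abs]
    rw [pow_mul |x|, sq_abs, ← pow_mul]
    ring

/-- If the characteristic function agrees near `0` with a function that is analytic in the disk of
radius `ρ`, then the exponential moments of order less than `ρ` are finite. -/
lemma integrable_exp_mul_of_charFun_analytic {ρ : ℝ} (hG : DifferentiableOn ℂ G (Metric.ball 0 ρ))
    (heq : ∀ᶠ t : ℝ in 𝓝 0, charFun μ t = G t) {x : ℝ} (hx : |x| < ρ) :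
    Integrable (fun y => Real.exp (x * y)) μ := by
  have hρ : 0 < ρ := (abs_nonneg x).trans_lt hx
  have hG0 : AnalyticAt ℂ G 0 := hG.analyticAt (Metric.ball_mem_nhds _ hρ)
  have hmem := memLp_id_of_charFun_analytic hG0 heq
  have hder : ∀ n, iteratedDeriv n G 0 = I ^ n * ((∫ y, y ^ n ∂μ : ℝ) : ℂ) := by
    intro n
    rw [← iteratedDeriv_charFun_zero (hmem n)]
    have heq' : charFun μ =ᶠ[𝓝 0] fun t : ℝ => G t := heq
    rw [heq'.iteratedDeriv_eq, iteratedDeriv_comp_ofReal _ (by simpa using hG0), ofReal_zero]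
  have hxm : (x : ℂ) ∈ Metric.ball (0 : ℂ) ρ := by simpa using hx
  have hsum := (Complex.hasSum_taylorSeries_on_ball hG hxm).summable.norm
  -- The even Taylor terms at `x` have modulus `E (x y) ^ (2k) / (2k)!`. Being nonnegative, the
  -- integrands can be summed under the integral, to `cosh (x y)`, which dominates `exp (x y) / 2`.
  have hinj : Function.Injective fun k : ℕ => 2 * k := fun a b h => by simpa using h
  have hsum2 := hsum.comp_injective hinj
  have hpow : ∀ k : ℕ, Integrable (fun y : ℝ => (x * y) ^ (2 * k) / (2 * k).factorial) μ := by
    intro k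
    have : Integrable (fun y : ℝ => ‖id y‖ ^ (2 * k)) μ := (hmem (2 * k)).integrable_norm_pow'
    have h2 : Integrable (fun y : ℝ => y ^ (2 * k)) μ := by simpa [pow_mul] using this
    simpa only [mul_pow] using (h2.const_mul (x ^ (2 * k))).div_const _
  have hnn : ∀ (k : ℕ) (y : ℝ), 0 ≤ (x * y) ^ (2 * k) / (2 * k).factorial := fun k y => by
    rw [pow_mul]; positivity
  have hsum3 : Summable fun k : ℕ => ∫ y, (x * y) ^ (2 * k) / (2 * k).factorial ∂μ := by
    refine hsum2.congr fun k => ?_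
    have hnn2 : 0 ≤ ∫ y, y ^ (2 * k) ∂μ :=
      integral_nonneg fun y => by rw [pow_mul]; positivity
    simp only [Function.comp_apply, hder, sub_zero, smul_eq_mul, norm_mul, norm_inv, norm_pow,
      norm_I, one_pow, one_mul, norm_real, Real.norm_eq_abs, norm_natCast, abs_of_nonneg hnn2,
      mul_pow, integral_div, integral_const_mul]
    rw [pow_mul |x|, sq_abs, ← pow_mul]
    ring
  have hcosh : Integrable (fun y => Real.cosh (x * y)) μ := by
    refine ⟨by fun_prop, ?_⟩
    have e : ∀ y, ‖Real.cosh (x * y)‖ₑ =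
        ∑' k : ℕ, ENNReal.ofReal ((x * y) ^ (2 * k) / (2 * k).factorial) := by
      intro y
      rw [Real.enorm_eq_ofReal (Real.cosh_pos _).le,
        ← ENNReal.ofReal_tsum_of_nonneg (hnn · y) (Real.hasSum_cosh _).summable,
        (Real.hasSum_cosh _).tsum_eq]
    rw [HasFiniteIntegral, lintegral_congr e, lintegral_tsum (fun k => by fun_prop)]
    simp_rw [← fun k => ofReal_integral_eq_lintegral_ofReal (hpow k) (ae_of_all _ (hnn k))]
    rw [← ENNReal.ofReal_tsum_of_nonneg (fun k => integral_nonneg (hnn k)) hsum3]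
    exact ENNReal.ofReal_lt_top
  refine (hcosh.const_mul 2).mono' (by fun_prop) (ae_of_all _ fun y => ?_)
  rw [Real.norm_eq_abs, Real.abs_exp, Real.cosh_eq]
  have := Real.exp_pos (-(x * y))
  linarith

end Moments

/-! ### Propagation of convergence to zero. -/

section Propagation

variable {f : ℕ → ℂ → ℂ} {c : ℂ} {R K : ℝ}

/-- Cauchy's integral formula and dominated convergence on the circle. -/
lemma tendsto_iteratedDeriv_zero_of_tendsto_zero {δ : ℝ} (hδ : 0 < δ)
    (hd : ∀ m, DifferentiableOn ℂ (f m) (Metric.closedBall c δ))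
    (hK : ∀ m, ∀ z ∈ Metric.sphere c δ, ‖f m z‖ ≤ K)
    (ht : ∀ z ∈ Metric.sphere c δ, Tendsto (fun m => f m z) atTop (𝓝 0)) (n : ℕ) :
    Tendsto (fun m => iteratedDeriv n (f m) c) atTop (𝓝 0) := by
  have hcont : ∀ m, ContinuousOn (fun z => (1 / (z - c) ^ (n + 1)) • f m z) (Metric.sphere c δ) := by
    intro m
    have hpow : ContinuousOn (fun z : ℂ => (z - c) ^ (n + 1)) (Metric.sphere c δ) := by fun_prop
    refine ContinuousOn.smul (continuousOn_const.div hpow ?_)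
      ((hd m).continuousOn.mono Metric.sphere_subset_closedBall)
    intro z hz
    exact pow_ne_zero _ (sub_ne_zero.2 (Metric.ne_of_mem_sphere hz hδ.ne'))
  have key : ∀ m, iteratedDeriv n (f m) c = (2 * Real.pi * I / n.factorial)⁻¹ *
      ∮ z in C(c, δ), (1 / (z - c) ^ (n + 1)) • f m z := by
    intro m
    rw [(hd m).circleIntegral_one_div_sub_center_pow_smul hδ n, smul_eq_mul, inv_mul_cancel_left₀]
    exact div_ne_zero two_pi_I_ne_zero (by exact_mod_cast n.factorial_ne_zero)
  simp_rw [key]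
  rw [show (0 : ℂ) = (2 * Real.pi * I / n.factorial)⁻¹ * 0 by simp]
  refine Tendsto.const_mul _ ?_
  have hmem : ∀ θ, circleMap c δ θ ∈ Metric.sphere c δ := circleMap_mem_sphere c hδ.le
  have hz : (0 : ℂ) = ∫ _θ in (0 : ℝ)..(2 * Real.pi), (0 : ℂ) := by simp
  rw [hz]
  refine intervalIntegral.tendsto_integral_filter_of_dominated_convergence
    (fun _ => δ * (1 / δ ^ (n + 1) * K)) (Eventually.of_forall fun m => ?_)
    (Eventually.of_forall fun m => ae_of_all _ fun θ _ => ?_) (by simp)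
    (ae_of_all _ fun θ _ => ?_)
  · exact (intervalIntegrable_iff.1 ((hcont m).circleIntegrable hδ.le).out).aestronglyMeasurable
  · have hs := mem_sphere_iff_norm.1 (hmem θ)
    rw [norm_smul, norm_smul, norm_div, norm_pow, hs, norm_one, deriv_circleMap, norm_mul, norm_I,
      mul_one, norm_circleMap_zero, abs_of_pos hδ]
    gcongr
    exact hK m _ (hmem θ)
  · simpa using ((ht _ (hmem θ)).const_smul (1 / (circleMap c δ θ - c) ^ (n + 1))).const_smul
      (deriv (circleMap c δ) θ)

/-- Each Taylor coefficient at `c` tends to zero, and Cauchy's estimates on a circle of radius `r'`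
between `‖z - c‖` and `R` give a geometric majorant for the series. -/
lemma tendsto_zero_on_ball_of_tendsto_zero_near_center
    (hd : ∀ m, DifferentiableOn ℂ (f m) (Metric.ball c R))
    (hK : ∀ m, ∀ z ∈ Metric.ball c R, ‖f m z‖ ≤ K)
    (ht : ∀ᶠ z in 𝓝 c, Tendsto (fun m => f m z) atTop (𝓝 0)) {z : ℂ} (hz : z ∈ Metric.ball c R) :
    Tendsto (fun m => f m z) atTop (𝓝 0) := by
  have hR : 0 < R := Metric.pos_of_mem_ball hz
  obtain ⟨η, hη, hηt⟩ := Metric.eventually_nhds_iff_ball.1 ht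
  set δ := min η R / 2
  have hm : 0 < min η R := lt_min hη hR
  have hδ : 0 < δ := half_pos hm
  have hδη : δ < η := (half_lt_self hm).trans_le (min_le_left _ _)
  have hδR : δ < R := (half_lt_self hm).trans_le (min_le_right _ _)
  have hder := tendsto_iteratedDeriv_zero_of_tendsto_zero (f := f) hδ
    (fun m => (hd m).mono (Metric.closedBall_subset_ball hδR))
    (fun m w hw => hK m w (Metric.closedBall_subset_ball hδR (Metric.sphere_subset_closedBall hw)))
    (fun w hw => hηt w (Metric.closedBall_subset_ball hδη (Metric.sphere_subset_closedBall hw)))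
  obtain ⟨r', hr1, hr2⟩ := exists_between (mem_ball_iff_norm.1 hz)
  have hr0 : 0 < r' := (norm_nonneg _).trans_lt hr1
  have hsum : ∀ m, f m z =
      ∑' n : ℕ, (n.factorial : ℂ)⁻¹ • (z - c) ^ n • iteratedDeriv n (f m) c := fun m =>
    (Complex.taylorSeries_eq_on_ball (hd m) hz).symm
  simp_rw [hsum]
  rw [show (0 : ℂ) = ∑' _ : ℕ, (0 : ℂ) by simp]
  refine tendsto_tsum_of_dominated_convergence (bound := fun n => K * (‖z - c‖ / r') ^ n)
    ((summable_geometric_of_lt_one (by positivity) ((div_lt_one hr0).2 hr1)).mul_left K)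
    (fun n => by simpa using ((hder n).const_smul ((z - c) ^ n)).const_smul (n.factorial : ℂ)⁻¹)
    (Eventually.of_forall fun m n => ?_)
  have hb := Complex.norm_iteratedDeriv_le_of_forall_mem_sphere_norm_le (f := f m) (C := K) n hr0
    (((hd m).mono (Metric.closedBall_subset_ball hr2)).diffContOnCl_ball subset_rfl)
    (fun w hw => hK m w (Metric.closedBall_subset_ball hr2 (Metric.sphere_subset_closedBall hw)))
  have hf : (0 : ℝ) < n.factorial := by exact_mod_cast n.factorial_pos
  rw [norm_smul, norm_smul, norm_inv, norm_natCast, norm_pow, inv_mul_le_iff₀ hf]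
  refine (mul_le_mul_of_nonneg_left hb (by positivity)).trans (le_of_eq ?_)
  rw [div_pow]
  ring

/-- A locally bounded sequence of holomorphic functions on a connected open set that tends to zero
near one point tends to zero everywhere (a part of Vitali's theorem). -/
lemma tendsto_zero_of_isPreconnected {U : Set ℂ} (hU : IsPreconnected U) (hUo : IsOpen U)
    (hd : ∀ m, DifferentiableOn ℂ (f m) U)
    (hb : ∀ z ∈ U, ∃ K : ℝ, ∀ᶠ w in 𝓝 z, ∀ m, ‖f m w‖ ≤ K) {z₀ : ℂ} (hz₀ : z₀ ∈ U)
    (ht : ∀ᶠ z in 𝓝 z₀, Tendsto (fun m => f m z) atTop (𝓝 0)) {z : ℂ} (hz : z ∈ U) :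
    Tendsto (fun m => f m z) atTop (𝓝 0) := by
  -- The set of points near which convergence holds is open; it remains to see that it is closed in
  -- `U`. A limit point `w` lies in a ball centred at a point `v` of the set on which the uniform
  -- bound still holds.
  suffices H : U ⊆ {z | ∀ᶠ w in 𝓝 z, Tendsto (fun m => f m w) atTop (𝓝 0)} from (H hz).self_of_nhds
  refine hU.subset_of_closure_inter_subset isOpen_setOfPred_eventually_nhds ⟨z₀, hz₀, ht⟩ ?_
  rintro w ⟨hwc, hwU⟩
  obtain ⟨K, hK⟩ := hb w hwU
  obtain ⟨ε, hε, hεb⟩ := Metric.eventually_nhds_iff_ball.1 (hK.and (hUo.mem_nhds hwU))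
  obtain ⟨v, hv, hvw⟩ := Metric.mem_closure_iff.1 hwc (ε / 2) (half_pos hε)
  have hsub : Metric.ball v (ε / 2) ⊆ Metric.ball w ε := by
    refine Metric.ball_subset_ball' ?_
    rw [dist_comm] at hvw
    linarith
  have hw : Metric.ball v (ε / 2) ∈ 𝓝 w := Metric.isOpen_ball.mem_nhds hvw
  filter_upwards [hw] with u hu
  exact tendsto_zero_on_ball_of_tendsto_zero_near_center
    (fun m => (hd m).mono fun x hx => (hεb x (hsub hx)).2)
    (fun m x hx => (hεb x (hsub hx)).1 m) hv hu

end Propagation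

/-! ### Power series with bounded coefficients. -/

/-- The sum of the power series whose coefficients are the terms of `a` from index `n` on. -/
noncomputable def tailSeries (a : ℕ → ℂ) (n : ℕ) (z : ℂ) : ℂ := ∑' j : ℕ, a (n + j) * z ^ j

section TailSeries

variable {a : ℕ → ℂ} {C : ℝ}

lemma norm_coeff_mul_pow_le (hC : ∀ n, ‖a n‖ ≤ C) {r : ℝ} {z : ℂ} (hz : ‖z‖ ≤ r) (n j : ℕ) :
    ‖a (n + j) * z ^ j‖ ≤ C * r ^ j := by
  rw [norm_mul, norm_pow]
  have : 0 ≤ C := (norm_nonneg _).trans (hC 0)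
  gcongr
  exact hC _

lemma summable_tailSeries (hC : ∀ n, ‖a n‖ ≤ C) {z : ℂ} (hz : ‖z‖ < 1) (n : ℕ) :
    Summable fun j : ℕ => a (n + j) * z ^ j :=
  .of_norm_bounded ((summable_geometric_of_lt_one (norm_nonneg z) hz).mul_left C)
    (norm_coeff_mul_pow_le hC le_rfl n)

lemma norm_tailSeries_le (hC : ∀ n, ‖a n‖ ≤ C) {r : ℝ} {z : ℂ} (hz : ‖z‖ ≤ r) (hr : r < 1) (n : ℕ) :
    ‖tailSeries a n z‖ ≤ C / (1 - r) := by
  have h0 : 0 ≤ r := (norm_nonneg z).trans hz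
  rw [div_eq_mul_inv]
  exact tsum_of_norm_bounded ((hasSum_geometric_of_lt_one h0 hr).mul_left C)
    (norm_coeff_mul_pow_le hC hz n)

lemma differentiableOn_tailSeries (hC : ∀ n, ‖a n‖ ≤ C) (n : ℕ) :
    DifferentiableOn ℂ (tailSeries a n) (Metric.ball 0 1) := by
  intro z hz
  obtain ⟨r, hr, hr1⟩ := exists_between (mem_ball_zero_iff.1 hz)
  have h0 : 0 ≤ r := (norm_nonneg z).trans hr.le
  have hd : DifferentiableOn ℂ (tailSeries a n) (Metric.ball 0 r) :=
    differentiableOn_tsum_of_summable_norm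
      ((summable_geometric_of_lt_one h0 hr1).mul_left C) (fun j => by fun_prop)
      Metric.isOpen_ball
      (fun j w hw => norm_coeff_mul_pow_le hC (mem_ball_zero_iff.1 hw).le n j)
  exact (hd.differentiableAt (Metric.isOpen_ball.mem_nhds (by simpa using hr))).differentiableWithinAt

lemma tailSeries_zero_right (a : ℕ → ℂ) (n : ℕ) : tailSeries a n 0 = a n := by
  rw [tailSeries, tsum_eq_single 0]
  · simp
  · intro j hj; simp [hj]

lemma tailSeries_eq_sum_add (hC : ∀ n, ‖a n‖ ≤ C) {z : ℂ} (hz : ‖z‖ < 1) (n m : ℕ) :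
    tailSeries a n z =
      ∑ j ∈ Finset.range m, a (n + j) * z ^ j + z ^ m * tailSeries a (n + m) z := by
  rw [tailSeries, ← (summable_tailSeries hC hz n).sum_add_tsum_nat_add m, tailSeries, ← tsum_mul_left]
  congr 1
  refine tsum_congr fun j => ?_
  rw [add_assoc n m j, add_comm m j]
  ring

end TailSeries

/-! ### Riesz's bound and Szegő's theorem. -/

/-- The rescaled remainder `(H z - ∑ k < n, a k z ^ k) / z ^ n`. -/
noncomputable def scaledRemainder (a : ℕ → ℂ) (H : ℂ → ℂ) (n : ℕ) (z : ℂ) : ℂ :=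
  (H z - ∑ k ∈ Finset.range n, a k * z ^ k) / z ^ n

section Remainder

variable {a : ℕ → ℂ} {C : ℝ} {H : ℂ → ℂ} {ζ : ℂ} {ε : ℝ}

lemma scaledRemainder_eq_tailSeries (hC : ∀ n, ‖a n‖ ≤ C) {z : ℂ} (hz : ‖z‖ < 1) (hz0 : z ≠ 0)
    (hH : H z = tailSeries a 0 z) (n : ℕ) : scaledRemainder a H n z = tailSeries a n z := by
  rw [scaledRemainder, hH, tailSeries_eq_sum_add hC hz 0 n, div_eq_iff (pow_ne_zero _ hz0)]
  simp only [zero_add]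
  ring

/-- If two blocks of `m` coefficients agree, the corresponding remainders shifted by `m` differ by
the original difference divided by `z ^ m`, which is small outside the unit disk. -/
lemma scaledRemainder_add {z : ℂ} (hz0 : z ≠ 0) (n m : ℕ) :
    scaledRemainder a H (n + m) z =
      (scaledRemainder a H n z - ∑ i ∈ Finset.range m, a (n + i) * z ^ i) / z ^ m := by
  have h1 : z ^ n ≠ 0 := pow_ne_zero _ hz0
  have h2 : z ^ m ≠ 0 := pow_ne_zero _ hz0
  rw [scaledRemainder, scaledRemainder, Finset.sum_range_add, pow_add]
  have : ∑ x ∈ Finset.range m, a (n + x) * z ^ (n + x) =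
      z ^ n * ∑ i ∈ Finset.range m, a (n + i) * z ^ i := by
    rw [Finset.mul_sum]
    exact Finset.sum_congr rfl fun i _ => by rw [pow_add]; ring
  rw [this]
  field_simp
  ring

/-- A geometric sum bounds the partial sum by `C ‖z‖ ^ n / (‖z‖ - 1)`; the factor `‖z‖ - 1` records
the blow-up at the circle. -/
lemma norm_scaledRemainder_mul_le_of_one_lt (hC : ∀ n, ‖a n‖ ≤ C) {z : ℂ} (hz : 1 < ‖z‖) (n : ℕ) :
    ‖scaledRemainder a H n z‖ * (‖z‖ - 1) ≤ ‖H z‖ * (‖z‖ - 1) + C := by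
  have h0 : 0 ≤ C := (norm_nonneg _).trans (hC 0)
  have hp : 0 < ‖z‖ - 1 := sub_pos.2 hz
  have hpow : 1 ≤ ‖z‖ ^ n := one_le_pow₀ hz.le
  have hs : ‖∑ k ∈ Finset.range n, a k * z ^ k‖ * (‖z‖ - 1) ≤ C * ‖z‖ ^ n := by
    have : ‖∑ k ∈ Finset.range n, a k * z ^ k‖ ≤ C * ∑ k ∈ Finset.range n, ‖z‖ ^ k := by
      rw [Finset.mul_sum]
      refine (norm_sum_le _ _).trans (Finset.sum_le_sum fun k _ => ?_)
      simpa using norm_coeff_mul_pow_le hC le_rfl 0 k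
    calc _ ≤ C * (∑ k ∈ Finset.range n, ‖z‖ ^ k) * (‖z‖ - 1) := by gcongr
      _ = C * (‖z‖ ^ n - 1) := by rw [mul_assoc, geom_sum_mul]
      _ ≤ _ := by gcongr; linarith
  rw [scaledRemainder, norm_div, norm_pow, div_mul_eq_mul_div, div_le_iff₀ (by positivity)]
  calc _ ≤ (‖H z‖ + ‖∑ k ∈ Finset.range n, a k * z ^ k‖) * (‖z‖ - 1) := by
        gcongr; exact norm_sub_le _ _
    _ ≤ ‖H z‖ * (‖z‖ - 1) * 1 + C * ‖z‖ ^ n := by linarith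
    _ ≤ ‖H z‖ * (‖z‖ - 1) * ‖z‖ ^ n + C * ‖z‖ ^ n := by gcongr
    _ = _ := by ring

/-- With `z = ζ (1 + ρ v)` and `|v| = 1`, one has `v² + ρ v + 1 = v (ρ + 2 re v)` and `‖z‖² - 1 = ρ
(ρ + 2 re v)`. So this polynomial vanishes exactly where the small circle meets the unit circle, at
the rate needed to cancel the blow-up of the remainders there. -/
lemma norm_quadratic_eq_on_sphere {ρ : ℝ} (hρ : 0 < ρ) (hζ : ‖ζ‖ = 1) {z : ℂ}
    (hz : z ∈ Metric.sphere ζ ρ) :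
    ‖((z / ζ - 1) / ρ) ^ 2 + ρ * ((z / ζ - 1) / ρ) + 1‖ = |‖z‖ ^ 2 - 1| / ρ := by
  have hζ0 : ζ ≠ 0 := by rw [← norm_ne_zero_iff, hζ]; exact one_ne_zero
  have hρ0 : (ρ : ℂ) ≠ 0 := by exact_mod_cast hρ.ne'
  set v : ℂ := (z / ζ - 1) / ρ with hv
  have hzv : z = ζ * (1 + ρ * v) := by rw [hv]; field_simp; ring
  have hvn : ‖v‖ = 1 := by
    have : v = (z - ζ) / (ζ * ρ) := by rw [hv]; field_simp
    rw [this, norm_div, norm_mul, hζ, mem_sphere_iff_norm.1 hz, norm_real, Real.norm_eq_abs,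
      abs_of_pos hρ, one_mul, div_self hρ.ne']
  have hvc : v * (starRingEnd ℂ) v = 1 := by rw [Complex.mul_conj, normSq_eq_norm_sq, hvn]; simp
  have hq : v ^ 2 + ρ * v + 1 = v * ((ρ + 2 * v.re : ℝ) : ℂ) := by
    have := Complex.add_conj v
    push_cast at this ⊢
    rw [← this]
    linear_combination -hvc
  have hnz : ‖z‖ ^ 2 - 1 = ρ * (ρ + 2 * v.re) := by
    rw [hzv, norm_mul, hζ, one_mul, ← normSq_eq_norm_sq, normSq_apply]
    have hv2 : v.re * v.re + v.im * v.im = 1 := by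
      rw [← normSq_apply, normSq_eq_norm_sq, hvn]; norm_num
    simp only [add_re, one_re, mul_re, ofReal_re, ofReal_im, zero_mul, sub_zero, add_im, one_im,
      mul_im, zero_add, add_zero]
    linear_combination ρ ^ 2 * hv2
  rw [hq, norm_mul, hvn, one_mul, norm_real, Real.norm_eq_abs, hnz, abs_mul, abs_of_pos hρ,
    mul_div_cancel_left₀ _ hρ.ne']

/-- M. Riesz's bound: if a power series with bounded coefficients continues analytically across
the point `ζ` of the unit circle then its rescaled remainders are uniformly bounded near `ζ`. -/
lemma exists_bound_scaledRemainder (hC : ∀ n, ‖a n‖ ≤ C) (hζ : ‖ζ‖ = 1) (hε : 0 < ε)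
    (hd : DifferentiableOn ℂ H (Metric.ball ζ ε))
    (hH : ∀ z ∈ Metric.ball ζ ε, ‖z‖ < 1 → H z = tailSeries a 0 z) :
    ∃ ρ > 0, ρ ≤ ε ∧ ρ < 1 ∧ ∃ K : ℝ, ∀ n, ∀ z ∈ Metric.ball ζ ρ, ‖scaledRemainder a H n z‖ ≤ K := by
  have hC0 : 0 ≤ C := (norm_nonneg _).trans (hC 0)
  have hζ0 : ζ ≠ 0 := by rw [← norm_ne_zero_iff, hζ]; exact one_ne_zero
  set ρ : ℝ := min (ε / 2) (1 / 2) with hρdef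
  have hρ : 0 < ρ := lt_min (half_pos hε) one_half_pos
  have hρε : ρ < ε := (min_le_left _ _).trans_lt (half_lt_self hε)
  have hρh : ρ ≤ 1 / 2 := min_le_right _ _
  have hcl : Metric.closedBall ζ ρ ⊆ Metric.ball ζ ε := Metric.closedBall_subset_ball hρε
  have hnb : ∀ z ∈ Metric.closedBall ζ ρ, 1 / 2 ≤ ‖z‖ ∧ ‖z‖ ≤ 3 / 2 := by
    intro z hz
    have h := mem_closedBall_iff_norm.1 hz
    have h1 := norm_sub_norm_le z ζ
    have h2 := norm_sub_norm_le ζ z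
    rw [norm_sub_rev] at h2
    constructor <;> linarith
  obtain ⟨K₀, hK₀⟩ := (isCompact_closedBall ζ ρ).exists_bound_of_continuousOn
    (hd.continuousOn.mono hcl)
  have hK₀0 : 0 ≤ K₀ := (norm_nonneg _).trans (hK₀ ζ (Metric.mem_closedBall_self hρ.le))
  set q : ℂ → ℂ := fun z => ((z / ζ - 1) / ρ) ^ 2 + ρ * ((z / ζ - 1) / ρ) + 1
  -- The bound inside the unit disk is `2 C / ρ` and outside it is `(5/4 K₀ + 5/2 C) / ρ`; this
  -- constant covers both.
  set K₁ := (2 * K₀ + 3 * C) / ρ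
  have hK₁ : 0 ≤ K₁ := by positivity
  have hsphere : ∀ n, ∀ z ∈ Metric.sphere ζ ρ, ‖scaledRemainder a H n z * q z‖ ≤ K₁ := by
    intro n z hz
    have hzc := Metric.sphere_subset_closedBall hz
    obtain ⟨hl, hu⟩ := hnb z hzc
    rw [norm_mul, norm_quadratic_eq_on_sphere hρ hζ hz, ← mul_div_assoc]
    refine div_le_div_of_nonneg_right ?_ hρ.le
    rcases lt_trichotomy ‖z‖ 1 with h | h | h
    · have hz0 : z ≠ 0 := by rw [← norm_pos_iff]; linarith
      have hb := norm_tailSeries_le hC le_rfl h n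
      rw [← scaledRemainder_eq_tailSeries hC h hz0 (hH z (hcl hzc) h) n,
        le_div_iff₀ (sub_pos.2 h)] at hb
      have hab : |‖z‖ ^ 2 - 1| = (1 - ‖z‖) * (1 + ‖z‖) := by
        rw [abs_of_nonpos (by nlinarith)]; ring
      rw [hab, ← mul_assoc]
      calc _ ≤ C * (1 + ‖z‖) := by gcongr
        _ ≤ _ := by nlinarith
    · rw [h]; norm_num; positivity
    · have hb := norm_scaledRemainder_mul_le_of_one_lt (H := H) hC h n
      have hab : |‖z‖ ^ 2 - 1| = (‖z‖ - 1) * (1 + ‖z‖) := by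
        rw [abs_of_nonneg (by nlinarith)]; ring
      rw [hab, ← mul_assoc]
      calc _ ≤ (‖H z‖ * (‖z‖ - 1) + C) * (1 + ‖z‖) := by gcongr
        _ ≤ (K₀ * (1 / 2) + C) * (1 + 3 / 2) := by
            gcongr
            · exact hK₀ z hzc
            · linarith
        _ ≤ _ := by linarith
  -- The maximum principle carries the bound for the product to the interior. On the ball of half
  -- the radius `|v| ≤ 1/2` and `ρ ≤ 1/2`, so `‖q‖ ≥ 1 - 1/4 - 1/4`; hence `2 * K₁`.
  refine ⟨ρ / 2, half_pos hρ, by linarith, by linarith, 2 * K₁, fun n z hz => ?_⟩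
  have hzn : ‖z - ζ‖ < ρ / 2 := mem_ball_iff_norm.1 hz
  have hdr : DifferentiableOn ℂ (fun z => scaledRemainder a H n z * q z) (Metric.closedBall ζ ρ) := by
    have hpow : DifferentiableOn ℂ (fun z : ℂ => z ^ n) (Metric.closedBall ζ ρ) := by fun_prop
    have hsum : DifferentiableOn ℂ (fun z => ∑ k ∈ Finset.range n, a k * z ^ k)
        (Metric.closedBall ζ ρ) := by fun_prop
    have hq : DifferentiableOn ℂ q (Metric.closedBall ζ ρ) := by fun_prop
    refine (((hd.mono hcl).sub hsum).div hpow fun z hz => pow_ne_zero _ ?_).mul hq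
    rw [← norm_pos_iff]
    linarith [(hnb z hz).1]
  have hmax : ‖scaledRemainder a H n z * q z‖ ≤ K₁ := by
    refine Complex.norm_le_of_forall_mem_frontier_norm_le Metric.isBounded_ball
      (hdr.diffContOnCl_ball subset_rfl)
      (fun w hw => hsphere n w (Metric.frontier_ball_subset_sphere hw)) (subset_closure ?_)
    exact Metric.ball_subset_ball (by linarith) hz
  have hq : 1 / 2 ≤ ‖q z‖ := by
    set v : ℂ := (z / ζ - 1) / ρ with hv
    have hvn : ‖v‖ ≤ 1 / 2 := by
      have hρ0 : (ρ : ℂ) ≠ 0 := by exact_mod_cast hρ.ne'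
      have : v = (z - ζ) / (ζ * ρ) := by rw [hv]; field_simp
      rw [this, norm_div, norm_mul, hζ, norm_real, Real.norm_eq_abs, abs_of_pos hρ, one_mul,
        div_le_iff₀ hρ]
      linarith
    have hqv : q z = v ^ 2 + ρ * v + 1 := rfl
    have h1 : ‖v ^ 2 + ρ * v‖ ≤ 1 / 2 := by
      refine (norm_add_le _ _).trans ?_
      rw [norm_pow, norm_mul, norm_real, Real.norm_eq_abs, abs_of_pos hρ]
      nlinarith [norm_nonneg v]
    have h2 := norm_sub_le (v ^ 2 + ρ * v + 1) (v ^ 2 + ρ * v)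
    rw [add_sub_cancel_left, norm_one] at h2
    rw [hqv]
    linarith
  rw [norm_mul] at hmax
  nlinarith [norm_nonneg (scaledRemainder a H n z)]

/-- If a power series with finitely many different coefficients continues analytically across a
point of the unit circle then a coefficient is determined by finitely many preceding ones. -/
lemma exists_coeff_determined (hfin : (Set.range a).Finite) (hζ : ‖ζ‖ = 1) (hε : 0 < ε)
    (hd : DifferentiableOn ℂ H (Metric.ball ζ ε))
    (hH : ∀ z ∈ Metric.ball ζ ε, ‖z‖ < 1 → H z = tailSeries a 0 z) :
    ∃ m : ℕ, ∀ p q : ℕ, (∀ i < m, a (p + i) = a (q + i)) → a (p + m) = a (q + m) := by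
  obtain ⟨C, hC'⟩ := hfin.isBounded.exists_norm_le
  have hC : ∀ n, ‖a n‖ ≤ C := fun n => hC' _ ⟨n, rfl⟩
  -- Otherwise every `m` has a pair of agreeing blocks of length `m` with different next
  -- coefficients. The differences of the shifted remainders decay outside the disk, hence on the
  -- whole ball around `ζ`, hence throughout the unit disk. At the origin they are differences of
  -- coefficients.
  by_contra! hcon
  choose p q hpq hne using hcon
  obtain ⟨ρ, hρ, hρε, hρ1, K, hK⟩ := exists_bound_scaledRemainder hC hζ hε hd hH
  have hball0 : ∀ z ∈ Metric.ball ζ ρ, z ≠ 0 := by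
    rintro z hz rfl
    rw [mem_ball_iff_norm, zero_sub, norm_neg, hζ] at hz
    linarith
  have hout : ∀ z ∈ Metric.ball ζ ρ, 1 < ‖z‖ → Tendsto (fun m => scaledRemainder a H (p m + m) z -
      scaledRemainder a H (q m + m) z) atTop (𝓝 0) := by
    intro z hz hz1
    refine squeeze_zero_norm (a := fun m => 2 * K * ‖z‖⁻¹ ^ m) (fun m => ?_) ?_
    · rw [scaledRemainder_add (hball0 z hz), scaledRemainder_add (hball0 z hz), ← sub_div,
        Finset.sum_congr rfl fun i hi => by rw [hpq m i (Finset.mem_range.1 hi)],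
        sub_sub_sub_cancel_right, norm_div, norm_pow, div_eq_mul_inv, inv_pow]
      gcongr
      have h1 := norm_sub_le (scaledRemainder a H (p m) z) (scaledRemainder a H (q m) z)
      linarith [hK (p m) z hz, hK (q m) z hz]
    · simpa using (tendsto_pow_atTop_nhds_zero_of_lt_one (by positivity)
        (inv_lt_one_of_one_lt₀ hz1)).const_mul (2 * K)
  have hin : ∀ z ∈ Metric.ball ζ ρ, Tendsto (fun m => scaledRemainder a H (p m + m) z -
      scaledRemainder a H (q m + m) z) atTop (𝓝 0) := by
    have hdr : ∀ n, DifferentiableOn ℂ (scaledRemainder a H n) (Metric.ball ζ ρ) := by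
      intro n
      have hpow : DifferentiableOn ℂ (fun z : ℂ => z ^ n) (Metric.ball ζ ρ) := by fun_prop
      have hsum : DifferentiableOn ℂ (fun z => ∑ k ∈ Finset.range n, a k * z ^ k)
        (Metric.ball ζ ρ) := by fun_prop
      exact ((hd.mono (Metric.ball_subset_ball hρε)).sub hsum).div hpow
        fun z hz => pow_ne_zero _ (hball0 z hz)
    intro z hz
    set z₀ : ℂ := ζ * (1 + ρ / 2 : ℝ) with hz₀
    have hz₀b : z₀ ∈ Metric.ball ζ ρ := by
      rw [mem_ball_iff_norm, hz₀]
      have : ζ * ((1 + ρ / 2 : ℝ) : ℂ) - ζ = ζ * ((ρ / 2 : ℝ) : ℂ) := by push_cast; ring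
      rw [this, norm_mul, hζ, one_mul, norm_real, Real.norm_eq_abs, abs_of_pos (half_pos hρ)]
      linarith
    have hz₀n : 1 < ‖z₀‖ := by
      rw [hz₀, norm_mul, hζ, one_mul, norm_real, Real.norm_eq_abs, abs_of_pos (by linarith)]
      linarith
    refine tendsto_zero_of_isPreconnected (f := fun m z => scaledRemainder a H (p m + m) z -
      scaledRemainder a H (q m + m) z) (convex_ball ζ ρ).isPreconnected Metric.isOpen_ball
      (fun m => (hdr _).sub (hdr _)) (fun w hw => ⟨K + K, ?_⟩) hz₀b ?_ hz
    · filter_upwards [Metric.isOpen_ball.mem_nhds hw] with v hv m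
      exact (norm_sub_le _ _).trans (add_le_add (hK _ v hv) (hK _ v hv))
    · filter_upwards [Metric.isOpen_ball.mem_nhds hz₀b,
        continuous_norm.continuousAt.eventually (lt_mem_nhds hz₀n)] with v hv hv1
      exact hout v hv hv1
  have hdisc : Tendsto (fun m => tailSeries a (p m + m) 0 - tailSeries a (q m + m) 0)
      atTop (𝓝 0) := by
    set z₁ : ℂ := ζ * (1 - ρ / 2 : ℝ) with hz₁
    have hz₁b : z₁ ∈ Metric.ball ζ ρ := by
      rw [mem_ball_iff_norm, hz₁]
      have : ζ * ((1 - ρ / 2 : ℝ) : ℂ) - ζ = -(ζ * ((ρ / 2 : ℝ) : ℂ)) := by push_cast; ring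
      rw [this, norm_neg, norm_mul, hζ, one_mul, norm_real, Real.norm_eq_abs,
        abs_of_pos (half_pos hρ)]
      linarith
    have hz₁n : ‖z₁‖ < 1 := by
      rw [hz₁, norm_mul, hζ, one_mul, norm_real, Real.norm_eq_abs, abs_of_pos (by linarith)]
      linarith
    refine tendsto_zero_of_isPreconnected (f := fun m z => tailSeries a (p m + m) z -
      tailSeries a (q m + m) z) (U := Metric.ball 0 1) (convex_ball 0 1).isPreconnected
      Metric.isOpen_ball (fun m => (differentiableOn_tailSeries hC _).sub
        (differentiableOn_tailSeries hC _)) (fun w hw => ?_)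
      (mem_ball_zero_iff.2 hz₁n) ?_ (by simp)
    · obtain ⟨r, hr, hr1⟩ := exists_between (mem_ball_zero_iff.1 hw)
      refine ⟨C / (1 - r) + C / (1 - r), ?_⟩
      filter_upwards [continuous_norm.continuousAt.eventually (gt_mem_nhds hr)] with v hv m
      exact (norm_sub_le _ _).trans
        (add_le_add (norm_tailSeries_le hC hv.le hr1 _) (norm_tailSeries_le hC hv.le hr1 _))
    · filter_upwards [Metric.isOpen_ball.mem_nhds hz₁b,
        continuous_norm.continuousAt.eventually (gt_mem_nhds hz₁n)] with v hv hv1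
      have hHv := hH v (Metric.ball_subset_ball hρε hv) hv1
      refine (hin v hv).congr fun m => ?_
      rw [scaledRemainder_eq_tailSeries hC hv1 (hball0 v hv) hHv,
        scaledRemainder_eq_tailSeries hC hv1 (hball0 v hv) hHv]
  simp only [tailSeries_zero_right] at hdisc
  -- The nonzero differences of coefficients form a finite set, so they cannot tend to zero.
  set S : Set ℂ := (Set.image2 (fun x y => x - y) (Set.range a) (Set.range a)) \ {0}
  have hS : S.Finite := (hfin.image2 _ hfin).sdiff
  have hSc : Sᶜ ∈ 𝓝 (0 : ℂ) := hS.isClosed.isOpen_compl.mem_nhds (by simp [S])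
  obtain ⟨m, hm⟩ := (hdisc.eventually hSc).exists
  exact hm ⟨⟨_, ⟨_, rfl⟩, _, ⟨_, rfl⟩, rfl⟩, sub_ne_zero.2 (hne m)⟩

/-- **Szegő's theorem**: if a power series with finitely many different coefficients continues
analytically across a point of the unit circle then its coefficients are eventually periodic. -/
theorem exists_eventually_periodic_coeff (hfin : (Set.range a).Finite) (hζ : ‖ζ‖ = 1) (hε : 0 < ε)
    (hd : DifferentiableOn ℂ H (Metric.ball ζ ε))
    (hH : ∀ z ∈ Metric.ball ζ ε, ‖z‖ < 1 → H z = tailSeries a 0 z) :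
    ∃ N P : ℕ, 0 < P ∧ ∀ j, a (N + P + j) = a (N + j) := by
  obtain ⟨m, hm⟩ := exists_coeff_determined hfin hζ hε hd hH
  have hmem : ∀ n : ℕ, (fun i : Fin m => a (n + i)) ∈
      {g : Fin m → ℂ | ∀ i, g i ∈ Set.range a} := fun n i => ⟨_, rfl⟩
  -- Pigeonhole: there are finitely many words of length `m`, so one occurs twice, and from there
  -- each coefficient is determined by the preceding `m`.
  obtain ⟨n, n', hlt, heq⟩ := (Set.Finite.pi' fun _ : Fin m => hfin).exists_lt_map_eq_of_forall_mem hmem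
  refine ⟨n, n' - n, Nat.sub_pos_of_lt hlt, fun j => ?_⟩
  rw [Nat.add_sub_cancel' hlt.le]
  induction j using Nat.strong_induction_on with
  | _ j ih =>
    rcases lt_or_ge j m with h | h
    · exact (congrFun heq ⟨j, h⟩).symm
    · have := hm (n' + (j - m)) (n + (j - m)) fun i hi => by
        rw [add_assoc, add_assoc]
        exact ih _ (by omega)
      rwa [add_assoc, add_assoc, Nat.sub_add_cancel h] at this

/-- A power series with eventually periodic coefficients is rational. -/
lemma exists_polynomial_of_periodic_coeff (hC : ∀ n, ‖a n‖ ≤ C) {N P : ℕ}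
    (hper : ∀ j, a (N + P + j) = a (N + j)) :
    ∃ Q : Polynomial ℂ, ∀ z : ℂ, ‖z‖ < 1 → (1 - z ^ P) * tailSeries a 0 z = Q.eval z := by
  -- The head of length `N` is kept; multiplying the periodic tail by `1 - z ^ P` leaves one period.
  refine ⟨(1 - Polynomial.X ^ P) * (∑ j ∈ Finset.range N, Polynomial.C (a j) * Polynomial.X ^ j)
    + Polynomial.X ^ N * (∑ j ∈ Finset.range P, Polynomial.C (a (N + j)) * Polynomial.X ^ j),
    fun z hz => ?_⟩
  have hper' : tailSeries a (N + P) z = tailSeries a N z := tsum_congr fun j => by rw [hper j]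
  have h1 := tailSeries_eq_sum_add hC hz 0 N
  have h2 := tailSeries_eq_sum_add hC hz N P
  rw [hper'] at h2
  simp only [zero_add] at h1
  simp only [Polynomial.eval_add, Polynomial.eval_mul, Polynomial.eval_sub, Polynomial.eval_one,
    Polynomial.eval_pow, Polynomial.eval_X, Polynomial.eval_finsetSum, Polynomial.eval_C]
  rw [h1]
  linear_combination z ^ N * h2

end Remainder

/-! ### Exclusion of poles and cancellation of simple roots. -/

/-- A solution `M ≢ 0` of `(z - w) ^ 2 * A * M' = B * M` can be analytic at `w` only if
`B w = 0`. -/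
lemma eq_zero_of_sq_mul_deriv_eq {M A B : ℂ → ℂ} {w : ℂ} (hM : AnalyticAt ℂ M w)
    (hne : ¬∀ᶠ z in 𝓝 w, M z = 0) (hA : ContinuousAt A w) (hB : ContinuousAt B w)
    (h : ∀ᶠ z in 𝓝 w, (z - w) ^ 2 * A z * deriv M z = B z * M z) : B w = 0 := by
  obtain ⟨n, N, hN, hN0, hMN⟩ := hM.exists_eventuallyEq_pow_smul_nonzero_iff.2 hne
  have hMN' : M =ᶠ[𝓝 w] fun z => (z - w) ^ n * N z := hMN
  -- After division by `(z - w) ^ n` the left side keeps a factor `z - w`, so the limit at `w` gives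
  -- `B w * N w = 0`.
  have key : ∀ᶠ z in 𝓝[≠] w,
      (z - w) * A z * (n * N z + (z - w) * deriv N z) = B z * N z := by
    filter_upwards [nhdsWithin_le_nhds h, nhdsWithin_le_nhds hMN'.eventuallyEq_nhds,
      nhdsWithin_le_nhds hN.eventually_analyticAt, self_mem_nhdsWithin] with z hz hz1 hz2 hz3
    have hzw : z - w ≠ 0 := sub_ne_zero.2 hz3
    have hd : deriv M z = n * (z - w) ^ (n - 1) * N z + (z - w) ^ n * deriv N z := by
      rw [hz1.deriv_eq]
      have h1 : HasDerivAt (fun z => (z - w) ^ n) (n * (z - w) ^ (n - 1)) z := by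
        simpa using ((hasDerivAt_id z).sub_const w).fun_pow n
      exact (h1.mul hz2.differentiableAt.hasDerivAt).deriv
    rw [hd, hz1.eq_of_nhds] at hz
    -- For `n = 0` the truncated exponent is harmless, since the factor `n` vanishes.
    have hp : n * (z - w) ^ (n - 1) * (z - w) = n * (z - w) ^ n := by
      rcases n with _ | n
      · simp
      · rw [Nat.add_sub_cancel, mul_assoc, ← pow_succ]
    refine mul_left_cancel₀ (pow_ne_zero n hzw) ?_
    linear_combination hz - (z - w) * A z * N z * hp
  have t0 : Tendsto (fun z : ℂ => z - w) (𝓝[≠] w) (𝓝 0) :=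
    ((continuous_id.sub continuous_const).tendsto' w 0 (by simp)).mono_left nhdsWithin_le_nhds
  have tA : Tendsto A (𝓝[≠] w) (𝓝 (A w)) := hA.tendsto.mono_left nhdsWithin_le_nhds
  have tB : Tendsto B (𝓝[≠] w) (𝓝 (B w)) := hB.tendsto.mono_left nhdsWithin_le_nhds
  have tN : Tendsto N (𝓝[≠] w) (𝓝 (N w)) :=
    hN.continuousAt.tendsto.mono_left nhdsWithin_le_nhds
  have tN' : Tendsto (deriv N) (𝓝[≠] w) (𝓝 (deriv N w)) :=
    hN.deriv.continuousAt.tendsto.mono_left nhdsWithin_le_nhds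
  have hlim := tendsto_nhds_unique
    (((t0.mul tA).mul ((tN.const_mul (n : ℂ)).add (t0.mul tN'))).congr' key) (tB.mul tN)
  simp only [zero_mul] at hlim
  exact (mul_eq_zero.1 hlim.symm).resolve_right hN0

lemma Polynomial.Separable.dvd_of_forall_root {K : Type*} [Field K] [IsAlgClosed K]
    {D G : Polynomial K} (hD : D.Separable) (h : ∀ w, D.IsRoot w → G.IsRoot w) : D ∣ G := by
  rcases eq_or_ne G 0 with rfl | hG
  · exact dvd_zero _
  refine (IsAlgClosed.splits D).dvd_of_roots_le_roots hD.ne_zero ?_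
  refine (Multiset.le_iff_subset (Polynomial.nodup_roots hD)).2 fun w hw => ?_
  exact (Polynomial.mem_roots hG).2 (h w (Polynomial.isRoot_of_mem_roots hw))

/-! ### The strip of analyticity and the rational form of the logarithm. -/

/-- The strip `-1 < re z < 1`. -/
def unitStrip : Set ℂ := Complex.re ⁻¹' Set.Ioo (-1) 1

lemma isOpen_unitStrip : IsOpen unitStrip := isOpen_Ioo.preimage Complex.continuous_re

lemma isPreconnected_unitStrip : IsPreconnected unitStrip :=
  ((convex_Ioo (-1 : ℝ) 1).linear_preimage Complex.reLm).isPreconnected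

lemma ball_subset_unitStrip : Metric.ball (0 : ℂ) 1 ⊆ unitStrip := fun z hz =>
  abs_lt.1 ((Complex.abs_re_le_norm z).trans_lt (mem_ball_zero_iff.1 hz))

lemma I_mem_unitStrip : I ∈ unitStrip := by simp [unitStrip]

lemma one_sub_sq_ne_zero_of_mem_unitStrip {z : ℂ} (hz : z ∈ unitStrip) : 1 - z ^ 2 ≠ 0 := by
  intro h
  have h' : (1 - z) * (1 + z) = 0 := by linear_combination h
  have hz' : -1 < z.re ∧ z.re < 1 := hz
  rcases mul_eq_zero.1 h' with h1 | h1
  · rw [← sub_eq_zero.1 h1] at hz'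
    simp at hz'
  · rw [eq_neg_of_add_eq_zero_right h1] at hz'
    simp at hz'

lemma mem_unitStrip_of_norm_eq_one {z : ℂ} (hz : ‖z‖ = 1) (h : 1 - z ^ 2 ≠ 0) : z ∈ unitStrip := by
  refine abs_lt.1 (lt_of_le_of_ne (hz ▸ Complex.abs_re_le_norm z) fun hre => h ?_)
  have him : z.im = 0 := Complex.abs_re_eq_norm.1 (hre.trans hz.symm)
  have hsq : z.re ^ 2 = 1 := by rw [← sq_abs, hre, one_pow]
  have hzr : z = (z.re : ℂ) := by apply Complex.ext <;> simp [him]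
  rw [hzr, ← ofReal_pow, hsq]
  simp

section Continuation

variable {c : ℕ → ℂ} {M : ℂ → ℂ}

lemma not_eventually_eq_zero_of_mem_unitStrip (hM : DifferentiableOn ℂ M unitStrip)
    (hM0 : M 0 ≠ 0) {w : ℂ} (hw : w ∈ unitStrip) : ¬∀ᶠ z in 𝓝 w, M z = 0 := fun h =>
  hM0 ((hM.analyticOnNhd isOpen_unitStrip).eqOn_zero_of_preconnected_of_eventuallyEq_zero
    isPreconnected_unitStrip hw h (ball_subset_unitStrip (Metric.mem_ball_self one_pos)))

/-- The zeros of `M` are isolated, so the points `exp (i t)` with `t ≠ π / 2` close to `π / 2` avoid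
them. -/
lemma exists_norm_eq_one_ne_zero (hM : DifferentiableOn ℂ M unitStrip) (hM0 : M 0 ≠ 0) :
    ∃ ζ : ℂ, ‖ζ‖ = 1 ∧ ζ ∈ unitStrip ∧ M ζ ≠ 0 := by
  have han := hM.analyticOnNhd isOpen_unitStrip I I_mem_unitStrip
  have hev := han.eventually_eq_zero_or_eventually_ne_zero.resolve_left
    (not_eventually_eq_zero_of_mem_unitStrip hM hM0 I_mem_unitStrip)
  have hd : HasDerivAt (fun t : ℝ => exp (t * I)) (exp ((Real.pi / 2 : ℝ) * I) * I)
      (Real.pi / 2) := by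
    have h1 : HasDerivAt (fun z : ℂ => exp (z * I)) (exp ((Real.pi / 2 : ℝ) * I) * I)
        ((Real.pi / 2 : ℝ) : ℂ) := by
      simpa using ((hasDerivAt_id ((Real.pi / 2 : ℝ) : ℂ)).mul_const I).cexp
    exact h1.comp_ofReal
  have ht := hd.tendsto_nhdsNE (mul_ne_zero (exp_ne_zero _) I_ne_zero)
  have hI : exp (((Real.pi / 2 : ℝ) : ℂ) * I) = I := by push_cast; exact exp_pi_div_two_mul_I
  rw [hI] at ht
  have hst : ∀ᶠ z in 𝓝[≠] I, z ∈ unitStrip :=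
    nhdsWithin_le_nhds (isOpen_unitStrip.mem_nhds I_mem_unitStrip)
  obtain ⟨t, h1, h2⟩ := (ht.eventually (hev.and hst)).exists
  exact ⟨_, norm_exp_ofReal_mul_I t, h2, h1⟩

/-- A primitive of `M' / M` near `ζ`, normalised at a point `z₁` inside the unit disk, has the same
derivative as the series on the convex intersection of the two disks. -/
lemma exists_log_continuation {C : ℝ} (hC : ∀ n, ‖c n‖ ≤ C) (hM : DifferentiableOn ℂ M unitStrip)
    (hexp : ∀ z ∈ Metric.ball (0 : ℂ) 1, M z = exp (tailSeries c 0 z)) :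
    ∃ (ζ : ℂ) (ε : ℝ) (H : ℂ → ℂ), ‖ζ‖ = 1 ∧ 0 < ε ∧ DifferentiableOn ℂ H (Metric.ball ζ ε) ∧
      ∀ z ∈ Metric.ball ζ ε, ‖z‖ < 1 → H z = tailSeries c 0 z := by
  have hM0 : M 0 ≠ 0 := by
    rw [hexp 0 (Metric.mem_ball_self one_pos)]; exact exp_ne_zero _
  obtain ⟨ζ, hζ, hζs, hζM⟩ := exists_norm_eq_one_ne_zero hM hM0
  have hcont : ContinuousAt M ζ :=
    (hM.differentiableAt (isOpen_unitStrip.mem_nhds hζs)).continuousAt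
  obtain ⟨ε, hε, hεb⟩ := Metric.eventually_nhds_iff_ball.1
    ((hcont.eventually_ne hζM).and (isOpen_unitStrip.mem_nhds hζs))
  have hMb : DifferentiableOn ℂ M (Metric.ball ζ ε) := hM.mono fun z hz => (hεb z hz).2
  have hdl : DifferentiableOn ℂ (fun z => deriv M z / M z) (Metric.ball ζ ε) :=
    (hMb.deriv Metric.isOpen_ball).div hMb fun z hz => (hεb z hz).1
  set s : ℝ := min (ε / 2) (1 / 2)
  have hs : 0 < s := lt_min (half_pos hε) one_half_pos
  have hsε : s < ε := (min_le_left _ _).trans_lt (half_lt_self hε)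
  have hs1 : s ≤ 1 / 2 := min_le_right _ _
  set z₁ : ℂ := ζ * ((1 - s : ℝ) : ℂ) with hz₁
  have hz₁b : z₁ ∈ Metric.ball ζ ε := by
    rw [mem_ball_iff_norm, hz₁]
    have : ζ * ((1 - s : ℝ) : ℂ) - ζ = -(ζ * (s : ℂ)) := by push_cast; ring
    rw [this, norm_neg, norm_mul, hζ, one_mul, norm_real, Real.norm_eq_abs, abs_of_pos hs]
    exact hsε
  have hz₁d : z₁ ∈ Metric.ball (0 : ℂ) 1 := by
    rw [mem_ball_zero_iff, hz₁, norm_mul, hζ, one_mul, norm_real, Real.norm_eq_abs,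
      abs_of_pos (by linarith)]
    linarith
  obtain ⟨H, hH1, hH⟩ := hdl.isExactOn_ball.with_val_at z₁ (tailSeries c 0 z₁)
  have hHd : DifferentiableOn ℂ H (Metric.ball ζ ε) :=
    fun z hz => (hH z hz).differentiableAt.differentiableWithinAt
  refine ⟨ζ, ε, H, hζ, hε, hHd, fun z hz hz1 => ?_⟩
  have hT := differentiableOn_tailSeries hC 0
  refine (Metric.isOpen_ball.inter Metric.isOpen_ball).eqOn_of_deriv_eq
    ((convex_ball ζ ε).inter (convex_ball 0 1)).isPreconnected (hHd.mono Set.inter_subset_left)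
    (hT.mono Set.inter_subset_right) ?_ ⟨hz₁b, hz₁d⟩ hH1 ⟨hz, mem_ball_zero_iff.2 hz1⟩
  rintro w ⟨hw1, hw2⟩
  have hMw : M =ᶠ[𝓝 w] fun z => exp (tailSeries c 0 z) := by
    filter_upwards [Metric.isOpen_ball.mem_nhds hw2] with v hv using hexp v hv
  have hTw := (hT.differentiableAt (Metric.isOpen_ball.mem_nhds hw2)).hasDerivAt
  rw [(hH w hw1).deriv, hMw.deriv_eq, hTw.cexp.deriv, hMw.eq_of_nhds,
    mul_div_cancel_left₀ _ (exp_ne_zero _)]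

/-- If `exp h`, where `h` has finitely many different Taylor coefficients, is analytic in the strip
`-1 < re z < 1`, then `h` is a rational function whose poles are simple and lie in `{1, -1}`. -/
theorem exists_rational_log (hfin : (Set.range c).Finite) (hM : DifferentiableOn ℂ M unitStrip)
    (hexp : ∀ z ∈ Metric.ball (0 : ℂ) 1, M z = exp (tailSeries c 0 z)) :
    ∃ R : Polynomial ℂ,
      (∀ z ∈ Metric.ball (0 : ℂ) 1, tailSeries c 0 z = R.eval z / (1 - z ^ 2)) ∧
      ∀ z ∈ unitStrip, M z = exp (R.eval z / (1 - z ^ 2)) := by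
  obtain ⟨C, hC'⟩ := hfin.isBounded.exists_norm_le
  have hC : ∀ n, ‖c n‖ ≤ C := fun n => hC' _ ⟨n, rfl⟩
  have h0 : (0 : ℂ) ∈ Metric.ball (0 : ℂ) 1 := Metric.mem_ball_self one_pos
  have hM0 : M 0 ≠ 0 := by rw [hexp 0 h0]; exact exp_ne_zero _
  have hMan := hM.analyticOnNhd isOpen_unitStrip
  obtain ⟨ζ, ε, H, hζ, hε, hHd, hH⟩ := exists_log_continuation hC hM hexp
  obtain ⟨N, P, hP, hper⟩ := exists_eventually_periodic_coeff hfin hζ hε hHd hH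
  obtain ⟨Q, hQ⟩ := exists_polynomial_of_periodic_coeff hC hper
  have hPC : (P : ℂ) ≠ 0 := by exact_mod_cast hP.ne'
  have hDne : ∀ z ∈ Metric.ball (0 : ℂ) 1, 1 - z ^ P ≠ 0 := by
    intro z hz h
    have h1 : ‖z ^ P‖ < 1 := by
      rw [norm_pow]; exact pow_lt_one₀ (norm_nonneg _) (mem_ball_zero_iff.1 hz) hP.ne'
    rw [← sub_eq_zero.1 h, norm_one] at h1
    exact lt_irrefl _ h1
  set D : Polynomial ℂ := 1 - Polynomial.X ^ P with hD
  set B : Polynomial ℂ := Polynomial.derivative Q * D - Q * Polynomial.derivative D with hB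
  have hDe : ∀ z, D.eval z = 1 - z ^ P := fun z => by simp [hD]
  -- Differentiating `M = exp (Q / D)` and clearing denominators gives an identity that extends from
  -- the disk to the whole strip, zeros of `D` included.
  have hode : Set.EqOn (fun z => D.eval z ^ 2 * deriv M z) (fun z => B.eval z * M z) unitStrip := by
    have han1 : AnalyticOnNhd ℂ (fun z => D.eval z ^ 2 * deriv M z) unitStrip :=
      fun z hz => ((D.differentiable.analyticAt z).pow 2).mul (hMan z hz).deriv
    have han2 : AnalyticOnNhd ℂ (fun z => B.eval z * M z) unitStrip :=
      fun z hz => (B.differentiable.analyticAt z).mul (hMan z hz)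
    refine han1.eqOn_of_preconnected_of_eventuallyEq han2 isPreconnected_unitStrip
      (ball_subset_unitStrip h0) ?_
    filter_upwards [Metric.isOpen_ball.mem_nhds h0] with z hz
    have hMz : M =ᶠ[𝓝 z] fun z => exp (Q.eval z / D.eval z) := by
      filter_upwards [Metric.isOpen_ball.mem_nhds hz] with v hv
      rw [hexp v hv, ← hQ v (mem_ball_zero_iff.1 hv), hDe, mul_div_cancel_left₀ _ (hDne v hv)]
    have hDz : D.eval z ≠ 0 := by rw [hDe]; exact hDne z hz
    have hd := ((Q.hasDerivAt z).fun_div (D.hasDerivAt z) hDz).cexp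
    rw [hMz.deriv_eq, hd.deriv, hMz.eq_of_nhds, hB]
    simp only [Polynomial.eval_sub, Polynomial.eval_mul]
    field_simp
  -- At a root `w ≠ ±1` of `D`, analyticity of `M` forces `B w = -Q w * D' w` to vanish; as `D' w ≠
  -- 0`, the numerator vanishes. Since `D` has simple roots, it then divides `Q * (1 - X ^ 2)`.
  have hroot : ∀ w, D.IsRoot w → (Q * (1 - Polynomial.X ^ 2)).IsRoot w := by
    intro w hw
    rw [Polynomial.IsRoot.def, Polynomial.eval_mul, mul_eq_zero]
    by_contra! hcon
    obtain ⟨hQw, hw2⟩ := hcon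
    simp only [Polynomial.eval_sub, Polynomial.eval_one, Polynomial.eval_pow,
      Polynomial.eval_X] at hw2
    have hwP : w ^ P = 1 := by
      have := hDe w
      rw [hw] at this
      exact (sub_eq_zero.1 this.symm).symm
    have hwn : ‖w‖ = 1 := by
      have := congrArg norm hwP
      rw [norm_pow, norm_one] at this
      exact (pow_eq_one_iff_of_nonneg (norm_nonneg w) hP.ne').1 this
    have hws := mem_unitStrip_of_norm_eq_one hwn hw2
    obtain ⟨A, hA⟩ := Polynomial.dvd_iff_isRoot.2 hw
    have hBw : B.eval w = 0 := by
      refine eq_zero_of_sq_mul_deriv_eq (M := M) (A := fun z => A.eval z ^ 2)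
        (B := fun z => B.eval z) (hMan w hws)
        (not_eventually_eq_zero_of_mem_unitStrip hM hM0 hws) (by fun_prop) (by fun_prop) ?_
      filter_upwards [isOpen_unitStrip.mem_nhds hws] with z hz
      have := hode hz
      simp only [hA, Polynomial.eval_mul, Polynomial.eval_sub, Polynomial.eval_X,
        Polynomial.eval_C] at this
      rw [← this]
      ring
    have hD' : (Polynomial.derivative D).eval w ≠ 0 := by
      have hw0 : w ≠ 0 := by rw [← norm_ne_zero_iff, hwn]; exact one_ne_zero
      simp [hD, Polynomial.derivative_X_pow, hPC, hw0]
    rw [hB, Polynomial.eval_sub, Polynomial.eval_mul, Polynomial.eval_mul, hw, mul_zero, zero_sub,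
      neg_eq_zero] at hBw
    exact (mul_ne_zero hQw hD') hBw
  have hsep : D.Separable := by
    have h1 : (Polynomial.X ^ P - 1 : Polynomial ℂ).Separable :=
      Polynomial.X_pow_sub_one_separable_iff.2 hPC
    have h2 : D ∣ Polynomial.X ^ P - 1 := ⟨-1, by rw [hD]; ring⟩
    exact h1.of_dvd h2
  obtain ⟨R, hR⟩ := hsep.dvd_of_forall_root hroot
  have htail : ∀ z ∈ Metric.ball (0 : ℂ) 1, tailSeries c 0 z = R.eval z / (1 - z ^ 2) := by
    intro z hz
    rw [eq_div_iff (one_sub_sq_ne_zero_of_mem_unitStrip (ball_subset_unitStrip hz))]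
    have h1 := congrArg (Polynomial.eval z) hR
    rw [Polynomial.eval_mul, Polynomial.eval_mul, hDe, ← hQ z (mem_ball_zero_iff.1 hz)] at h1
    refine mul_left_cancel₀ (hDne z hz) ?_
    rw [← h1]
    simp
    ring
  refine ⟨R, htail, ?_⟩
  have han : AnalyticOnNhd ℂ (fun z => exp (R.eval z / (1 - z ^ 2))) unitStrip := by
    refine DifferentiableOn.analyticOnNhd (fun z hz => ?_) isOpen_unitStrip
    have h1 : DifferentiableAt ℂ (fun z : ℂ => 1 - z ^ 2) z := by fun_prop
    exact (R.differentiableAt.fun_div h1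
      (one_sub_sq_ne_zero_of_mem_unitStrip hz)).cexp.differentiableWithinAt
  refine hMan.eqOn_of_preconnected_of_eventuallyEq han isPreconnected_unitStrip
    (ball_subset_unitStrip h0) ?_
  filter_upwards [Metric.isOpen_ball.mem_nhds h0] with z hz
  rw [hexp z hz, htail z hz]

end Continuation

/-! ### Polynomials with the ridge property. -/

section Marcinkiewicz

lemma Polynomial.tendsto_eval_mul_div_pow_natDegree (p : Polynomial ℂ) (u : ℂ) :
    Tendsto (fun s : ℝ => p.eval ((s : ℂ) * u) / (s : ℂ) ^ p.natDegree) atTop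
      (𝓝 (p.leadingCoeff * u ^ p.natDegree)) := by
  have hterm : ∀ k ∈ Finset.range p.natDegree,
      Tendsto (fun s : ℝ => p.coeff k * u ^ k * ((s : ℂ) ^ k / (s : ℂ) ^ p.natDegree)) atTop
        (𝓝 (p.coeff k * u ^ k * 0)) := by
    intro k hk
    refine Tendsto.const_mul _ ?_
    have := tendsto_pow_div_pow_atTop_zero (𝕜 := ℝ) (Finset.mem_range.1 hk)
    have h2 := (Complex.continuous_ofReal.tendsto 0).comp this
    simpa [Function.comp_def] using h2
  have hsum := (tendsto_finsetSum _ hterm).add_const (p.leadingCoeff * u ^ p.natDegree)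
  simp only [mul_zero, Finset.sum_const_zero, zero_add] at hsum
  refine hsum.congr' ?_
  filter_upwards [eventually_gt_atTop 0] with s hs
  have hs0 : (s : ℂ) ^ p.natDegree ≠ 0 := pow_ne_zero _ (by exact_mod_cast hs.ne')
  rw [Polynomial.eval_eq_sum_range, Finset.sum_range_succ, add_div, Finset.sum_div]
  congr 1
  · refine Finset.sum_congr rfl fun k _ => ?_
    rw [mul_pow]
    ring
  · rw [mul_pow, Polynomial.leadingCoeff]
    field_simp

variable {p : Polynomial ℂ}

/-- A polynomial whose real part does not increase when one moves vertically to the real line has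
degree at most two. -/
lemma natDegree_le_two_of_ridge (h : ∀ z : ℂ, (p.eval z).re ≤ (p.eval (z.re : ℂ)).re) :
    p.natDegree ≤ 2 := by
  by_contra! hn
  set n := p.natDegree with hndef
  set c := p.leadingCoeff
  have hn0 : (0 : ℝ) < n := by exact_mod_cast (by omega)
  have hn3 : (3 : ℝ) ≤ n := by exact_mod_cast hn
  have hnC : (n : ℂ) ≠ 0 := by exact_mod_cast hn0.ne'
  -- The ridge inequality at `z = s * exp (i θ)`, divided by `s ^ n` as `s → ∞`. The angles `2π/n`,
  -- `π/n` and `±π/(2n)` then force `c = 0`; the first needs `n ≥ 3` to lie below `π`.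
  have key : ∀ θ : ℝ, (c * exp (n * (θ * I))).re ≤ c.re * Real.cos θ ^ n := by
    intro θ
    have t1 := (Complex.continuous_re.tendsto _).comp
      (p.tendsto_eval_mul_div_pow_natDegree (exp (θ * I)))
    have t2 := (Complex.continuous_re.tendsto _).comp
      (p.tendsto_eval_mul_div_pow_natDegree ((Real.cos θ : ℝ) : ℂ))
    have hle := le_of_tendsto_of_tendsto t1 t2 (by
      filter_upwards [eventually_gt_atTop 0] with s hs
      simp only [Function.comp_apply, ← ofReal_pow, div_ofReal_re]
      refine div_le_div_of_nonneg_right ?_ (by positivity)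
      refine (h _).trans (le_of_eq ?_)
      rw [re_ofReal_mul, exp_ofReal_mul_I_re, ofReal_mul])
    rw [← hndef, ← exp_nat_mul, ← ofReal_pow, re_mul_ofReal] at hle
    exact hle
  have hcos : ∀ θ : ℝ, 0 < θ → θ < Real.pi → |Real.cos θ| < 1 := by
    intro θ h0 h1
    rw [← sq_lt_one_iff_abs_lt_one]
    have := Real.sin_pos_of_pos_of_lt_pi h0 h1
    nlinarith [Real.sin_sq_add_cos_sq θ]
  have hcosn : ∀ θ : ℝ, 0 < θ → θ < Real.pi → |Real.cos θ ^ n| < 1 := by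
    intro θ h0 h1
    rw [abs_pow]
    exact pow_lt_one₀ (abs_nonneg _) (hcos θ h0 h1) (by omega)
  have hpi := Real.pi_pos
  have hre1 : c.re ≤ 0 := by
    have h1 := key (2 * Real.pi / n)
    have e : exp ((n : ℂ) * (((2 * Real.pi / n : ℝ) : ℂ) * I)) = 1 := by
      rw [← exp_two_pi_mul_I]; congr 1; push_cast; field_simp
    rw [e, mul_one] at h1
    have h2 := (abs_lt.1 (hcosn (2 * Real.pi / n) (by positivity)
      (by rw [div_lt_iff₀ hn0]; nlinarith))).2
    nlinarith
  have hre2 : 0 ≤ c.re := by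
    have h1 := key (Real.pi / n)
    have e : exp ((n : ℂ) * (((Real.pi / n : ℝ) : ℂ) * I)) = -1 := by
      rw [← exp_pi_mul_I]; congr 1; push_cast; field_simp
    rw [e, mul_neg_one, neg_re] at h1
    have h2 := (abs_lt.1 (hcosn (Real.pi / n) (by positivity)
      (by rw [div_lt_iff₀ hn0]; nlinarith))).1
    nlinarith
  have hre : c.re = 0 := le_antisymm hre1 hre2
  have him1 : 0 ≤ c.im := by
    have h1 := key (Real.pi / 2 / n)
    have e : exp ((n : ℂ) * (((Real.pi / 2 / n : ℝ) : ℂ) * I)) = I :=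
      (congrArg exp (by push_cast; field_simp)).trans exp_pi_div_two_mul_I
    rw [e, hre, zero_mul, mul_I_re] at h1
    linarith
  have him2 : c.im ≤ 0 := by
    have h1 := key (-(Real.pi / 2 / n))
    have e : exp ((n : ℂ) * (((-(Real.pi / 2 / n) : ℝ) : ℂ) * I)) = -I :=
      (congrArg exp (by push_cast; field_simp)).trans exp_neg_pi_div_two_mul_I
    rw [e, hre, zero_mul, mul_neg, neg_re, mul_I_re] at h1
    linarith
  have hc : c = 0 := Complex.ext hre (le_antisymm him2 him1)
  rw [Polynomial.leadingCoeff_eq_zero.1 hc] at hndef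
  simp at hndef
  omega

lemma exists_real_quadratic_of_ridge (h : ∀ z : ℂ, (p.eval z).re ≤ (p.eval (z.re : ℂ)).re)
    (h0 : p.eval 0 = 0) :
    ∃ σ a : ℝ, 0 ≤ σ ∧ ∀ z, p.eval z = (a : ℂ) * z + (σ : ℂ) ^ 2 * z ^ 2 := by
  have hdeg := natDegree_le_two_of_ridge h
  have hev : ∀ z, p.eval z = p.coeff 1 * z + p.coeff 2 * z ^ 2 := by
    intro z
    have hc0 : p.coeff 0 = 0 := by rw [Polynomial.coeff_zero_eq_eval_zero, h0]
    rw [Polynomial.eval_eq_sum_range' (Nat.lt_succ_of_le hdeg)]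
    simp [Finset.sum_range_succ, hc0]
  set b := p.coeff 1
  set d := p.coeff 2
  have key : ∀ x y : ℝ, 0 ≤ b.im * y + d.re * y ^ 2 + 2 * d.im * x * y := by
    intro x y
    have := h ⟨x, y⟩
    rw [hev, hev] at this
    simp [pow_two] at this
    linarith
  have hdi : d.im = 0 := by
    by_contra hne
    -- This `x` makes the expression equal to `-1` at `y = 1`.
    have := key (-(b.im + d.re + 1) / (2 * d.im)) 1
    have e : 2 * d.im * (-(b.im + d.re + 1) / (2 * d.im)) = -(b.im + d.re + 1) := by field_simp
    rw [e] at this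
    linarith
  have hdr : 0 ≤ d.re := by
    have h1 := key 0 1
    have h2 := key 0 (-1)
    linarith
  have hbi : b.im = 0 := by
    -- The `+ 1` keeps the denominator positive; the value is minus the square of `b.im / (d.re +
    -- 1)`.
    have h1 := key 0 (-b.im / (d.re + 1))
    have e : b.im * (-b.im / (d.re + 1)) + d.re * (-b.im / (d.re + 1)) ^ 2 +
        2 * d.im * 0 * (-b.im / (d.re + 1)) = -(b.im / (d.re + 1)) ^ 2 := by
      field_simp
      ring
    rw [e] at h1
    have h2 : b.im / (d.re + 1) = 0 := by nlinarith [sq_nonneg (b.im / (d.re + 1))]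
    rcases div_eq_zero_iff.1 h2 with h3 | h3
    · exact h3
    · linarith
  refine ⟨Real.sqrt d.re, b.re, Real.sqrt_nonneg _, fun z => ?_⟩
  have hb : b = (b.re : ℂ) := Complex.ext (by simp) (by simp [hbi])
  have hd : d = (d.re : ℂ) := Complex.ext (by simp) (by simp [hdi])
  rw [hev, ← ofReal_pow, Real.sq_sqrt hdr, ← hd, ← hb]

end Marcinkiewicz

/-! ### From the characteristic function to the moment generating function and back. -/

section LogCharFun

variable {μ : Measure ℝ}

/-- The Taylor coefficients of the cumulant generating function. -/
noncomputable def cumulantCoeff (μ : Measure ℝ) (k : ℕ) : ℂ := charCumulant μ k / (k.factorial : ℂ)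

/-- The logarithm of the analytic extension is analytic near `0`, where the extension equals `1`;
the powers of `i` in its Taylor coefficients are absorbed by the variable `t * I`. -/
lemma charFun_eventually_eq_exp_tailSeries [IsProbabilityMeasure μ] {r : ℝ} (hr : 0 < r)
    (hanalytic : CharFunAnalyticInDisk μ r) :
    ∀ᶠ t : ℝ in 𝓝 0, charFun μ t = exp (tailSeries (cumulantCoeff μ) 0 (t * I)) := by
  obtain ⟨F, hF, hFeq⟩ := hanalytic
  have hF1 : F 0 = 1 := by simpa using hFeq 0 (by simpa using hr)
  have hF0 : AnalyticAt ℂ F 0 := hF 0 (Metric.mem_ball_self hr)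
  have hL : AnalyticAt ℂ (fun z => log (F z)) 0 := hF0.clog (by rw [hF1]; exact one_mem_slitPlane)
  have hev : ∀ᶠ t : ℝ in 𝓝 0, F t = charFun μ t := by
    have : ∀ᶠ t : ℝ in 𝓝 0, |t| < r := by
      have := continuous_abs.continuousAt (x := (0 : ℝ)) |>.eventually
        (gt_mem_nhds (by simpa using hr))
      exact this
    exact this.mono hFeq
  have hder : ∀ n, iteratedDeriv n (fun z => log (F z)) 0 = I ^ n * charCumulant μ n := by
    intro n
    have h1 : (fun t : ℝ => log (charFun μ t)) =ᶠ[𝓝 0] fun t : ℝ => log (F t) :=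
      hev.mono fun t ht => by simp only [ht]
    have h2 := iteratedDeriv_comp_ofReal (G := fun z => log (F z)) n (s := 0) (by simpa using hL)
    rw [ofReal_zero] at h2
    rw [charCumulant, h1.iteratedDeriv_eq, h2, mul_inv_cancel_left₀ (pow_ne_zero _ I_ne_zero)]
  obtain ⟨δ, hδ, hδb⟩ := Metric.eventually_nhds_iff_ball.1
    (hL.eventually_analyticAt.and (hF0.continuousAt.eventually_ne (hF1 ▸ one_ne_zero)))
  have hLd : DifferentiableOn ℂ (fun z => log (F z)) (Metric.ball 0 δ) :=
    fun z hz => (hδb z hz).1.differentiableAt.differentiableWithinAt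
  have hofReal : Tendsto (fun t : ℝ => (t : ℂ)) (𝓝 0) (𝓝 0) :=
    Complex.continuous_ofReal.tendsto' _ _ (by simp)
  filter_upwards [hev, hofReal.eventually (Metric.ball_mem_nhds 0 hδ)] with t h1 h2
  rw [← h1, ← exp_log (hδb _ h2).2, ← Complex.taylorSeries_eq_on_ball hLd h2]
  congr 1
  refine tsum_congr fun n => ?_
  rw [hder, cumulantCoeff, smul_eq_mul, smul_eq_mul, sub_zero, zero_add, mul_pow]
  ring

lemma mem_interior_integrableExpSet_of_abs_lt {ρ : ℝ}
    (h : ∀ x : ℝ, |x| < ρ → Integrable (fun y => Real.exp (x * y)) μ) {x : ℝ} (hx : |x| < ρ) :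
    x ∈ interior (integrableExpSet id μ) :=
  mem_interior.2 ⟨Set.Ioo (-ρ) ρ, fun y hy => h y (abs_lt.2 hy), isOpen_Ioo, abs_lt.1 hx⟩

lemma tendsto_ofReal_mul_I_nhdsNE :
    Tendsto (fun t : ℝ => (t : ℂ) * I) (𝓝[≠] 0) (𝓝[≠] 0) := by
  refine tendsto_nhdsWithin_iff.2 ⟨?_, ?_⟩
  · exact ((Complex.continuous_ofReal.mul continuous_const).tendsto' 0 0 (by simp)).mono_left
      nhdsWithin_le_nhds
  · filter_upwards [self_mem_nhdsWithin] with t ht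
    exact mul_ne_zero (ofReal_ne_zero.2 ht) I_ne_zero

/-- If the characteristic function is locally the exponential of a function `E` that is analytic in
a disk, then the moment generating function exists in the corresponding strip, and is `exp E`
in the disk. -/
lemma integrable_and_complexMGF_eq_of_charFun_eq_exp [IsProbabilityMeasure μ] {ρ : ℝ} {E : ℂ → ℂ}
    (hE : DifferentiableOn ℂ E (Metric.ball 0 ρ))
    (heq : ∀ᶠ t : ℝ in 𝓝 0, charFun μ t = exp (E (t * I))) :
    (∀ x : ℝ, |x| < ρ → x ∈ interior (integrableExpSet id μ)) ∧
      ∀ z ∈ Metric.ball (0 : ℂ) ρ, complexMGF id μ z = exp (E z) := by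
  have hG : DifferentiableOn ℂ (fun z => exp (E (z * I))) (Metric.ball 0 ρ) := by
    refine DifferentiableOn.cexp (hE.fun_comp (by fun_prop) fun z hz => ?_)
    simpa using hz
  have hint : ∀ x : ℝ, |x| < ρ → x ∈ interior (integrableExpSet id μ) := fun x hx =>
    mem_interior_integrableExpSet_of_abs_lt
      (fun y hy => integrable_exp_mul_of_charFun_analytic hG heq hy) hx
  refine ⟨hint, fun z hz => ?_⟩
  have hρ := Metric.pos_of_mem_ball hz
  have han1 : AnalyticOnNhd ℂ (complexMGF id μ) (Metric.ball 0 ρ) := fun w hw =>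
    analyticAt_complexMGF (hint _ ((abs_re_le_norm w).trans_lt (mem_ball_zero_iff.1 hw)))
  have han2 : AnalyticOnNhd ℂ (fun w => exp (E w)) (Metric.ball 0 ρ) :=
    hE.cexp.analyticOnNhd Metric.isOpen_ball
  -- Identity theorem: on the imaginary axis near `0` the moment generating function is the
  -- characteristic function.
  refine han1.eqOn_of_preconnected_of_frequently_eq han2 (convex_ball 0 ρ).isPreconnected
    (Metric.mem_ball_self hρ) ?_ hz
  refine tendsto_ofReal_mul_I_nhdsNE.frequently (Eventually.frequently ?_)
  filter_upwards [nhdsWithin_le_nhds heq] with t ht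
  rw [complexMGF_id_mul_I, ht]

/-- The ridge property of the moment generating function, for an exponential of a polynomial. -/
lemma ridge_of_complexMGF_eq_exp {p : Polynomial ℂ}
    (h : ∀ z, complexMGF id μ z = exp (p.eval z)) (z : ℂ) :
    (p.eval z).re ≤ (p.eval (z.re : ℂ)).re := by
  have h1 := norm_complexMGF_le_mgf (X := id) (μ := μ) (z := z)
  have h2 : mgf id μ z.re ≤ ‖complexMGF id μ (z.re : ℂ)‖ := by
    rw [complexMGF_ofReal, norm_real]; exact le_abs_self _
  have h3 := h1.trans h2
  rw [h, h, norm_exp, norm_exp] at h3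
  exact Real.exp_le_exp.1 h3

/-- The formula for `g` is required only off `±i`, so the reduced fractions, which may differ there
from the unreduced one under division by zero, also qualify. -/
lemma isLogCharFun_of_rational [IsProbabilityMeasure μ] {C : ℝ} (hC : ∀ n, ‖cumulantCoeff μ n‖ ≤ C)
    {R : Polynomial ℂ}
    (htail : ∀ z ∈ Metric.ball (0 : ℂ) 1,
      tailSeries (cumulantCoeff μ) 0 z = R.eval z / (1 - z ^ 2))
    (hmgf : ∀ z ∈ unitStrip, complexMGF id μ z = exp (R.eval z / (1 - z ^ 2)))
    {g : ℂ → ℂ} (hg : ∀ z, 1 + z ^ 2 ≠ 0 → g z = R.eval (z * I) / (1 + z ^ 2)) :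
    IsLogCharFun μ g := by
  have hsq : ∀ z : ℂ, 1 + z ^ 2 = 1 - (z * I) ^ 2 := fun z => by rw [mul_pow, I_sq]; ring
  have hre : ∀ t : ℝ, (1 : ℂ) + (t : ℂ) ^ 2 ≠ 0 := fun t => by
    have : (0 : ℝ) < 1 + t ^ 2 := by positivity
    exact_mod_cast this.ne'
  have hball : ∀ z : ℂ, ‖z‖ < 1 → g z = tailSeries (cumulantCoeff μ) 0 (z * I) := by
    intro z hz
    have hzI : z * I ∈ Metric.ball (0 : ℂ) 1 := by simpa using hz
    have hne := one_sub_sq_ne_zero_of_mem_unitStrip (ball_subset_unitStrip hzI)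
    rw [← hsq] at hne
    rw [htail _ hzI, hg z hne, hsq]
  refine ⟨?_, ?_, fun t => ?_, ?_⟩
  · rw [hball 0 (by simp), zero_mul, tailSeries_zero_right]
    simp [cumulantCoeff, charCumulant]
  · simp_rw [fun t : ℝ => hg t (hre t)]
    have h1 : Continuous fun t : ℝ => R.eval ((t : ℂ) * I) :=
      R.continuous.comp (Complex.continuous_ofReal.mul continuous_const)
    exact h1.div (by fun_prop) hre
  · have hs : (t : ℂ) * I ∈ unitStrip := by simp [unitStrip]
    rw [hg t (hre t), hsq, ← hmgf _ hs, complexMGF_id_mul_I]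
  · filter_upwards [Metric.ball_mem_nhds (0 : ℂ) one_pos] with z hz
    have hz1 : ‖z‖ < 1 := mem_ball_zero_iff.1 hz
    rw [hball z hz1]
    have hsum := (summable_tailSeries hC (z := z * I) (by simpa using hz1) 0).hasSum
    convert! hsum using 2 with k
    rw [zero_add, cumulantCoeff, mul_pow]
    ring

end LogCharFun

/-! ### Separation into cases by the poles at `±1`. -/

theorem theorem3 (μ : Measure ℝ) [IsProbabilityMeasure μ]
    (hnondeg : ∀ c : ℝ, μ ≠ Measure.dirac c)
    (r : ℝ) (hr : 0 < r) (hanalytic : CharFunAnalyticInDisk μ r)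
    (hfinite : (cumulantRatios μ).Finite) :
    (∃ σ a : ℝ, 0 ≤ σ ∧
      IsLogCharFun μ (fun z => -(σ : ℂ) ^ 2 * z ^ 2 + I * (a : ℂ) * z)) ∨
    (∃ P : Polynomial ℂ,
      (P.eval I ≠ 0 ∧ IsLogCharFun μ (fun z => P.eval z / (1 + I * z))) ∨
      (P.eval (-I) ≠ 0 ∧ IsLogCharFun μ (fun z => P.eval z / (1 - I * z)))) ∨
    (∃ P : Polynomial ℂ, P.eval I ≠ 0 ∧ P.eval (-I) ≠ 0 ∧
      IsLogCharFun μ (fun z => P.eval z / (1 + z ^ 2))) := by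
  have hfin : (Set.range (cumulantCoeff μ)).Finite := hfinite
  obtain ⟨C, hC'⟩ := hfin.isBounded.exists_norm_le
  have hC : ∀ n, ‖cumulantCoeff μ n‖ ≤ C := fun n => hC' _ ⟨n, rfl⟩
  have hlog := charFun_eventually_eq_exp_tailSeries hr hanalytic
  obtain ⟨hint, hmgf⟩ :=
    integrable_and_complexMGF_eq_of_charFun_eq_exp (differentiableOn_tailSeries hC 0) hlog
  have hM : DifferentiableOn ℂ (complexMGF id μ) unitStrip := fun z hz =>
    (analyticAt_complexMGF (hint _ (abs_lt.2 hz))).differentiableAt.differentiableWithinAt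
  obtain ⟨R, htail, hstrip⟩ := exists_rational_log hfin hM hmgf
  have hfinal : ∀ g : ℂ → ℂ, (∀ z, 1 + z ^ 2 ≠ 0 → g z = R.eval (z * I) / (1 + z ^ 2)) →
      IsLogCharFun μ g := fun g hg => isLogCharFun_of_rational hC htail hstrip hg
  have hcomp : ∀ (S : Polynomial ℂ) (z : ℂ),
      (S.comp (Polynomial.X * Polynomial.C I)).eval z = S.eval (z * I) := fun S z => by
    rw [Polynomial.eval_comp, Polynomial.eval_mul, Polynomial.eval_X, Polynomial.eval_C]
  have hI : -I * I = 1 := by rw [neg_mul, I_mul_I, neg_neg]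
  have hfac : ∀ z : ℂ, 1 + z ^ 2 = (1 + I * z) * (1 - I * z) := fun z => by
    linear_combination z ^ 2 * I_sq
  by_cases h1 : R.eval 1 = 0
  · obtain ⟨R₁, hR₁⟩ := Polynomial.dvd_iff_isRoot.2 (show R.IsRoot 1 from h1)
    have hR₁e : ∀ z, R.eval z = (z - 1) * R₁.eval z := fun z => by rw [hR₁]; simp
    by_cases h2 : R₁.eval (-1) = 0
    · left
      obtain ⟨R₂, hR₂⟩ := Polynomial.dvd_iff_isRoot.2 (show R₁.IsRoot (-1) from h2)
      have hRe : ∀ z, R.eval z = (1 - z ^ 2) * (-R₂).eval z := fun z => by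
        rw [hR₁e, hR₂]; simp; ring
      have hquot : ∀ z, 1 - z ^ 2 ≠ 0 → R.eval z / (1 - z ^ 2) = (-R₂).eval z := fun z hz => by
        rw [hRe, mul_div_cancel_left₀ _ hz]
      have htail' : ∀ z ∈ Metric.ball (0 : ℂ) 1,
          tailSeries (cumulantCoeff μ) 0 z = (-R₂).eval z := fun z hz => by
        rw [htail z hz,
          hquot z (one_sub_sq_ne_zero_of_mem_unitStrip (ball_subset_unitStrip hz))]
      have hcf : ∀ᶠ t : ℝ in 𝓝 0, charFun μ t = exp ((-R₂).eval (t * I)) := by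
        have hb : ∀ᶠ t : ℝ in 𝓝 0, (t : ℂ) * I ∈ Metric.ball (0 : ℂ) 1 :=
          ((Complex.continuous_ofReal.mul continuous_const).tendsto' 0 0 (by simp)).eventually
            (Metric.ball_mem_nhds _ one_pos)
        filter_upwards [hlog, hb] with t ht htb
        rw [ht, htail' _ htb]
      -- A polynomial is analytic in every disk, so the radius can be chosen to contain any given
      -- `z`.
      have hentire : ∀ z, complexMGF id μ z = exp ((-R₂).eval z) := fun z =>
        (integrable_and_complexMGF_eq_of_charFun_eq_exp (ρ := ‖z‖ + 1)
          (-R₂).differentiable.differentiableOn hcf).2 z (by simp)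
      have hzero : (-R₂).eval 0 = 0 := by
        rw [← htail' 0 (Metric.mem_ball_self one_pos), tailSeries_zero_right]
        simp [cumulantCoeff, charCumulant]
      obtain ⟨σ, a, hσ, hquad⟩ :=
        exists_real_quadratic_of_ridge (ridge_of_complexMGF_eq_exp hentire) hzero
      refine ⟨σ, a, hσ, hfinal _ fun z hz => ?_⟩
      have hsq : 1 + z ^ 2 = 1 - (z * I) ^ 2 := by rw [mul_pow, I_sq]; ring
      rw [hsq] at hz ⊢
      rw [hquot _ hz, hquad, mul_pow, I_sq]
      ring
    · right; left
      -- Here `h = -R₁ / (1 + z)` with `z` replaced by `i t`, and the numerator at `t = i` is `-R₁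
      -- (-1)`.
      refine ⟨-(R₁.comp (Polynomial.X * Polynomial.C I)), Or.inl ⟨?_, hfinal _ fun z hz => ?_⟩⟩
      · rw [Polynomial.eval_neg, hcomp, I_mul_I]
        exact neg_ne_zero.2 h2
      · rw [Polynomial.eval_neg, hcomp, hR₁e]
        rw [hfac] at hz ⊢
        rw [div_eq_div_iff (left_ne_zero_of_mul hz) hz]
        ring
  · by_cases h2 : R.eval (-1) = 0
    · right; left
      obtain ⟨R₁, hR₁⟩ := Polynomial.dvd_iff_isRoot.2 (show R.IsRoot (-1) from h2)
      have hR₁e : ∀ z, R.eval z = (z + 1) * R₁.eval z := fun z => by rw [hR₁]; simp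
      -- Here `h = R₁ / (1 - z)`, and the numerator at `t = -i` is `R₁ 1 = R 1 / 2`.
      refine ⟨R₁.comp (Polynomial.X * Polynomial.C I), Or.inr ⟨?_, hfinal _ fun z hz => ?_⟩⟩
      · rw [hcomp, hI]
        intro h
        exact h1 (by rw [hR₁e, h, mul_zero])
      · rw [hcomp, hR₁e]
        rw [hfac] at hz ⊢
        rw [div_eq_div_iff (right_ne_zero_of_mul hz) hz]
        ring
    · right; right
      refine ⟨R.comp (Polynomial.X * Polynomial.C I), ?_, ?_, hfinal _ fun z _ => ?_⟩
      · rwa [hcomp, I_mul_I]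
      · rwa [hcomp, hI]
      · rw [hcomp]
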